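/- **Setting.** There are $n\ge 1$ items. A consumer type is a valuation vector $v\in\mathbb{R}_{\ge 0}^n$, and $\mathcal C$ is an arbitrary probability distribution on types. A *lottery* is a pair $(\phi,p)$ with $\phi\in\mathbb{R}_{\ge0}^n$, $\sum_i\phi_i\le 1$ and price $p>0$; it yields item $i$ with probability $\phi_i$ and nothing with probability $1-\sum_i\phi_i$. A *lottery system* is a set $\Lambda$ of lotteries that is closed in $\mathbb{R}^n\times\mathbb{R}$. In the *buy-many model* a consumer of type $v$ may buy any finite multiset (bundle) of lotteries of $\Lambda$, the empty one included. She receives an independent sample from each and keeps the best, so her utility is the expected maximum of the values of the items received ($0$ if none) minus the total price. She buys a utility-maximizing bundle and, among these, a most expensive one. The revenue of $\Lambda$ is her expected payment for $v\sim\mathcal C$; $r^*_L(\mathcal C)\in[0,\infty]$ is the supremum of the revenues of all lottery systems, and $\Lambda$ is *optimal* for $\mathcal C$ if it attains it. An *item pricing* is a vector $q\in[0,\infty]^n$ ($q_i=\infty$: item $i$ is not offered). Type $v$ buys an item maximizing $v_i-q_i$ (a most expensive one among ties), or nothing if this maximum is negative; the revenue is the expected payment, and $r^*(\mathcal C)$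 is the supremum of the revenues of all item pricings. **Rounding algorithm.** Given a lottery system $\Lambda$: 1. For each item $i$ let $p_i$ be the price of the cheapest lottery $(\phi,p)\in\Lambda$ with $\phi_i\ge 1/(130n^3)$ ($p_i=\infty$ if there is none). 2. With probability $1/2$, draw $t$ uniformly from $\{-1,0,\dots,3\lfloor\log_2 n\rfloor+9\}$ and output the prices $2^tp_i$, $i=1,\dots,n$. 3. Otherwise draw an item $i$ uniformly at random and $j\in\{0,1,2,\dots\}$ with probability $(1-1/e)e^{-j}$; output the price $130n^3e^jp_i$ for item $i$ and $\infty$ for every other item. **Theorem.** There is a universal constant $K>0$ such that for every $n\ge 1$: (a) For every $\mathcal C$ and every lottery system $\Lambda$ that is optimal for $\mathcal C$ and in which $\mathcal C$-almost every consumer type buys at most one lottery (some most expensive utility-maximizing bundle has at most one element), the item pricing returned by the algorithm on $\Lambda$ has expected revenue $r$ with $$ r^*_L(\mathcal C)\;\le\;K\,(1+\ln n)\; r .$$ (b) For every $\mathcal C$, $\; r^*_L(\mathcal C)\le K\,(1+\ln n)\; r^*(\mathcal C)$. (c) The assumption in (a) that consumers buy at most one lottery is without loss of generality: every lottery system $\Lambda$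 is contained in a lottery system $\Lambda'$ in which every type buys at most one lottery and pays exactly what it pays under $\Lambda$. -/

import Mathlib

open scoped ENNReal NNReal

namespace BuyMany

/-- A lottery over `n` items: its probability vector together with its price. -/
abbrev Lottery (n : ℕ) : Type := (Fin n → ℝ) × ℝ

/-- A lottery system: a closed set of lotteries with sub-probability vectors and positive prices. -/
structure IsLotterySystem {n : ℕ} (S : Set (Lottery n)) : Prop where
  isClosed : IsClosed S
  prob_nonneg : ∀ l ∈ S, ∀ i, 0 ≤ l.1 i
  prob_sum_le_one : ∀ l ∈ S, ∑ i, l.1 i ≤ 1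
  price_pos : ∀ l ∈ S, 0 < l.2

/-- The probability of each outcome of a lottery; `none` means that no item is received. -/
def outcomeProb {n : ℕ} (φ : Fin n → ℝ) : Option (Fin n) → ℝ
  | none => 1 - ∑ i, φ i
  | some i => φ i

/-- The value of an outcome to a consumer with valuation vector `v`. -/
def outcomeValue {n : ℕ} (v : Fin n → ℝ≥0) : Option (Fin n) → ℝ≥0
  | none => 0
  | some i => v i

/-- Expected value of the best item received when one independent sample is drawn from each of the
lotteries `b 0, …, b (m - 1)`; it is `0` for the empty bundle. -/
noncomputable def bundleValue {n m : ℕ} (v : Fin n → ℝ≥0) (b : Fin m → Lottery n) : ℝ :=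
  ∑ o : Fin m → Option (Fin n),
    (∏ j, outcomeProb (b j).1 (o j)) *
      ((Finset.univ.sup fun j => outcomeValue v (o j) : ℝ≥0) : ℝ)

/-- Total price of a bundle. -/
noncomputable def bundlePrice {n m : ℕ} (b : Fin m → Lottery n) : ℝ := ∑ j, (b j).2

/-- Utility of a consumer with valuation vector `v` who buys the bundle `b`. -/
noncomputable def bundleUtility {n m : ℕ} (v : Fin n → ℝ≥0) (b : Fin m → Lottery n) : ℝ :=
  bundleValue v b - bundlePrice b

/-- `b` is a utility-maximizing bundle from `S` (of any size, repetitions allowed). -/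
def IsOptimalBundle {n m : ℕ} (S : Set (Lottery n)) (v : Fin n → ℝ≥0)
    (b : Fin m → Lottery n) : Prop :=
  (∀ j, b j ∈ S) ∧
    ∀ (m' : ℕ) (b' : Fin m' → Lottery n), (∀ j, b' j ∈ S) →
      bundleUtility v b' ≤ bundleUtility v b

/-- What a consumer of type `v` pays: the price of a most expensive utility-maximizing bundle. -/
noncomputable def payment {n : ℕ} (S : Set (Lottery n)) (v : Fin n → ℝ≥0) : ℝ≥0∞ :=
  ⨆ (m : ℕ) (b : Fin m → Lottery n) (_ : IsOptimalBundle S v b), ENNReal.ofReal (bundlePrice b)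

/-- The bundle bought by a consumer of type `v` can be taken to be a single lottery or empty. -/
def BuysSingle {n : ℕ} (S : Set (Lottery n)) (v : Fin n → ℝ≥0) : Prop :=
  ∃ (m : ℕ) (b : Fin m → Lottery n), m ≤ 1 ∧ IsOptimalBundle S v b ∧
    ENNReal.ofReal (bundlePrice b) = payment S v

/-- Revenue of the lottery system `S` for consumer distribution `C`. -/
noncomputable def lotteryRevenue {n : ℕ} (C : MeasureTheory.Measure (Fin n → ℝ≥0))
    (S : Set (Lottery n)) : ℝ≥0∞ :=
  ∫⁻ v, payment S v ∂C

/-- Optimal revenue of lottery systems. -/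
noncomputable def optLotteryRevenue {n : ℕ} (C : MeasureTheory.Measure (Fin n → ℝ≥0)) : ℝ≥0∞ :=
  ⨆ (S : Set (Lottery n)) (_ : IsLotterySystem S), lotteryRevenue C S

/-- `S` is a revenue-maximizing lottery system. -/
def IsOptimalSystem {n : ℕ} (C : MeasureTheory.Measure (Fin n → ℝ≥0))
    (S : Set (Lottery n)) : Prop :=
  IsLotterySystem S ∧ ∀ S' : Set (Lottery n), IsLotterySystem S' →
    lotteryRevenue C S' ≤ lotteryRevenue C S

/-- Under the item prices `q` (where `∞` means that the item is not offered), item `i` is a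
utility-maximizing choice for type `v`: `v i - q i ≥ 0` and `v k - q k ≤ v i - q i` for all `k`. -/
def IsBestItem {n : ℕ} (q : Fin n → ℝ≥0∞) (v : Fin n → ℝ≥0) (i : Fin n) : Prop :=
  q i ≤ (v i : ℝ≥0∞) ∧ ∀ k, (v k : ℝ≥0∞) + q i ≤ (v i : ℝ≥0∞) + q k

/-- What a consumer of type `v` pays under item prices `q`: the highest price of a
utility-maximizing item, or `0` if every item gives negative utility. -/
noncomputable def itemPayment {n : ℕ} (q : Fin n → ℝ≥0∞) (v : Fin n → ℝ≥0) : ℝ≥0∞ :=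
  ⨆ (i : Fin n) (_ : IsBestItem q v i), q i

/-- Revenue of the item pricing `q` for consumer distribution `C`. -/
noncomputable def itemRevenue {n : ℕ} (C : MeasureTheory.Measure (Fin n → ℝ≥0))
    (q : Fin n → ℝ≥0∞) : ℝ≥0∞ :=
  ∫⁻ v, itemPayment q v ∂C

/-- Optimal revenue of item pricings. -/
noncomputable def optItemRevenue {n : ℕ} (C : MeasureTheory.Measure (Fin n → ℝ≥0)) : ℝ≥0∞ :=
  ⨆ q : Fin n → ℝ≥0∞, itemRevenue C q

/-- Base price of item `i`: the price of the cheapest lottery in `S` that gives item `i` with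
probability at least `1 / (130 n ^ 3)`, and `∞` if there is none. -/
noncomputable def basePrice {n : ℕ} (S : Set (Lottery n)) (i : Fin n) : ℝ≥0∞ :=
  ⨅ (l : Lottery n) (_ : l ∈ S ∧ 1 / (130 * (n : ℝ) ^ 3) ≤ l.1 i), ENNReal.ofReal l.2

/-- The first branch of the rounding: draw `t` uniformly from `{-1, 0, …, 3 ⌊log₂ n⌋ + 9}` and
multiply all base prices by `2 ^ t`. -/
noncomputable def scaleAll {n : ℕ} (p : Fin n → ℝ≥0∞) : PMF (Fin n → ℝ≥0∞) :=
  (PMF.uniformOfFinset (Finset.Icc (-1 : ℤ) (3 * (Nat.log 2 n : ℤ) + 9))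
    (Finset.nonempty_Icc.mpr (by omega))).map fun t i => (2 : ℝ≥0∞) ^ t * p i

theorem geometric_tsum :
    HasSum (fun j : ℕ => ENNReal.ofReal ((1 - (Real.exp 1)⁻¹) * (Real.exp 1)⁻¹ ^ j)) 1 := by
  have h0 : 0 ≤ (Real.exp 1)⁻¹ := inv_nonneg.mpr (Real.exp_pos 1).le
  have h1 : (Real.exp 1)⁻¹ < 1 := inv_lt_one_of_one_lt₀ (Real.one_lt_exp_iff.mpr one_pos)
  have h := (hasSum_geometric_of_lt_one h0 h1).mul_left (1 - (Real.exp 1)⁻¹)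
  rw [mul_inv_cancel₀ (sub_pos.mpr h1).ne'] at h
  rw [ENNReal.summable.hasSum_iff, ← ENNReal.ofReal_tsum_of_nonneg
    (fun j => mul_nonneg (sub_pos.mpr h1).le (pow_nonneg h0 j)) h.summable, h.tsum_eq,
    ENNReal.ofReal_one]

/-- The law on `ℕ` giving `j` the probability `(1 - 1 / e) e ^ (-j)`. -/
noncomputable def geometricLaw : PMF ℕ :=
  ⟨fun j => ENNReal.ofReal ((1 - (Real.exp 1)⁻¹) * (Real.exp 1)⁻¹ ^ j), geometric_tsum⟩

/-- The second branch of the rounding: draw an item `i` uniformly, and `j` with probability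
`(1 - 1 / e) e ^ (-j)`; price item `i` at `130 n ^ 3 e ^ j` times its base price, and all other
items at `∞`. -/
noncomputable def scaleOne {n : ℕ} [NeZero n] (p : Fin n → ℝ≥0∞) : PMF (Fin n → ℝ≥0∞) :=
  (PMF.uniformOfFintype (Fin n)).bind fun i =>
    geometricLaw.map fun j =>
      Function.update (fun _ => ∞) i
        (130 * (n : ℝ≥0∞) ^ 3 * ENNReal.ofReal (Real.exp 1) ^ j * p i)

/-- The law of the item pricing returned by the rounding algorithm on the lottery system `S`: a
fair coin decides between the two branches. -/
noncomputable def roundedPricing {n : ℕ} [NeZero n] (S : Set (Lottery n)) :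
    PMF (Fin n → ℝ≥0∞) :=
  (PMF.uniformOfFintype Bool).bind fun c =>
    if c then scaleAll (basePrice S) else scaleOne (basePrice S)

/-- Expected revenue of the item pricing returned by the rounding algorithm. -/
noncomputable def roundedRevenue {n : ℕ} [NeZero n] (C : MeasureTheory.Measure (Fin n → ℝ≥0))
    (S : Set (Lottery n)) : ℝ≥0∞ :=
  ∑' q : Fin n → ℝ≥0∞, roundedPricing S q * itemRevenue C q

end BuyMany

namespace BuyMany

/-! Fix a type v that buys a single lottery l of price P, let p be the base prices, and let w(s) =
max_i (v_i - s p_i)^+ be the surplus under the prices s p (`surplus`). An item bought at scale s is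
still available at scale s', so w(s) - w(s') is at most s'/s times the payment at scale s.
Telescoping over the O(1 + log n) scales of the first branch bounds w(1/2) - w(`topScale`), where
`topScale` = 130 n^3 e^5, by a constant times the payments at these scales (`surplus_sub_le`).

Beyond `topScale` the type can imitate the surplus with the lotteries of the system. At each scale
growing by e, buying 130 n^3 copies of the cheapest lottery for the best item misses that item with
probability at most 1/e, exactly what is needed to pass from w(es) to w(s)
(`IsLotterySystem.exists_list_surplus_le`). This bundle costs a geometrically weighted sum of
payments, `tailPay`.

Let V be the highest value of an item of base price at most P. Items of value above V occur in l
only with tiny probability, so adding any lottery to l would realize at least 2/3 of its expected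
excess over V. Optimality of l bounds these excesses by 3/2 of the price, and comparison with the
imitating bundle gives P/2 ≤ (w(1/2) - w(`topScale`)) + `smallExcess` + tail
(`IsLotterySystem.exists_threshold`).

If `smallExcess` is below 3P/8 it is absorbed. Otherwise a competing system, `boosted`, multiplies
the tiny probabilities by 130 n^2. Either the surplus drop is at least P, or the utility the type
loses when the prices of `boosted` grow eightfold is at least 15P
(`IsLotterySystem.boosted_alternative`). Each doubling of prices loses at most one payment, so the
integrated loss is at most three times the optimal revenue.

After integration the tail and the competitor contribute at most 1/3 of the optimal revenue, hence
at most 2/3 of the revenue of a system that is optimal up to a factor 2. They are absorbed and the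
first branch alone gives the bound (`IsLotterySystem.revenue_le_rounded`). Absorption fails when the
revenue is infinite; there `smallExcess` is bounded by a constant depending on the system only, and
the second branch pays for the tail (`IsLotterySystem.roundedRevenue_eq_top`).

Part (b) applies this to near-optimal systems after truncating to bounded types. Part (c) adds to
the system all single lotteries that draw from a whole bundle and keep one outcome by a fixed choice
rule (`IsLotterySystem.exists_buysSingle`). -/

variable {n : ℕ}

/-! ### Expected best value of a list of lotteries. -/

/-- All outcomes of the lottery have nonnegative probability. -/
def Valid (l : Lottery n) : Prop := ∀ o, 0 ≤ outcomeProb l.1 o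

theorem sum_outcomeProb (φ : Fin n → ℝ) : ∑ o, outcomeProb φ o = 1 := by
  simp [Fintype.sum_option, outcomeProb]

theorem sum_outcomeProb_mul (φ : Fin n → ℝ) (g : Option (Fin n) → ℝ) :
    ∑ o, outcomeProb φ o * g o = g none + ∑ i, φ i * (g (some i) - g none) := by
  simp only [Fintype.sum_option, outcomeProb, mul_sub, Finset.sum_sub_distrib, ← Finset.sum_mul]
  ring

theorem IsLotterySystem.valid {S : Set (Lottery n)} (hS : IsLotterySystem S) {l : Lottery n}
    (hl : l ∈ S) : Valid l
  | none => sub_nonneg.2 (hS.prob_sum_le_one l hl)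
  | some i => hS.prob_nonneg l hl i

/-- Expectation of `h` at the maximum of `x` and the best value drawn from the lotteries of a
list. -/
noncomputable def expectBest (v : Fin n → ℝ≥0) (h : ℝ → ℝ) : List (Lottery n) → ℝ → ℝ
  | [], x => h x
  | l :: L, x => ∑ o, outcomeProb l.1 o * expectBest v h L (max x (outcomeValue v o))

/-- Total price of a list of lotteries. -/
noncomputable def listPrice (L : List (Lottery n)) : ℝ := (L.map Prod.snd).sum

/-- The recursion carries a test function and a starting value so that concatenation becomes
composition. -/
theorem expectBest_append (v : Fin n → ℝ≥0) (h : ℝ → ℝ) (L₁ L₂ : List (Lottery n)) (x : ℝ) :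
    expectBest v h (L₁ ++ L₂) x = expectBest v (expectBest v h L₂) L₁ x := by
  induction L₁ generalizing x with
  | nil => rfl
  | cons l L ih => simp [expectBest, ih]

theorem expectBest_monotone {v : Fin n → ℝ≥0} {h : ℝ → ℝ} (hh : Monotone h)
    {L : List (Lottery n)} (hL : ∀ l ∈ L, Valid l) : Monotone (expectBest v h L) := by
  induction L with
  | nil => exact hh
  | cons l L ih =>
    intro x y hxy
    refine Finset.sum_le_sum fun o _ => mul_le_mul_of_nonneg_left ?_ (hL l (by simp) o)
    exact ih (fun l hl => hL l (by simp [hl])) (max_le_max_right _ hxy)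

theorem le_expectBest {v : Fin n → ℝ≥0} {L : List (Lottery n)} (hL : ∀ l ∈ L, Valid l) (x : ℝ) :
    x ≤ expectBest v id L x := by
  induction L generalizing x with
  | nil => exact le_rfl
  | cons l L ih =>
    have ih := fun y => ih (fun l hl => hL l (by simp [hl])) y
    calc x = ∑ o, outcomeProb l.1 o * x := by rw [← Finset.sum_mul, sum_outcomeProb, one_mul]
      _ ≤ _ := Finset.sum_le_sum fun o _ => mul_le_mul_of_nonneg_left
        ((le_max_left _ _).trans (ih _)) (hL l (by simp) o)

/-- The expected best value of a list is at most a threshold plus the expected excesses. -/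
theorem expectBest_le {v : Fin n → ℝ≥0} {V : ℝ} (hV : 0 ≤ V) {L : List (Lottery n)}
    (hL : ∀ l ∈ L, Valid l) (x : ℝ) :
    expectBest v id L x ≤ V + max (x - V) 0 +
      (L.map fun l => ∑ i, l.1 i * max ((v i : ℝ) - V) 0).sum := by
  induction L generalizing x with
  | nil => simpa [expectBest] using by linarith [le_max_left (x - V) 0]
  | cons l L ih =>
    have ih := fun y => ih (fun l hl => hL l (by simp [hl])) y
    set T := (L.map fun l => ∑ i, l.1 i * max ((v i : ℝ) - V) 0).sum
    -- The excess of a maximum is at most the sum of the excesses, so the bound is additive over the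
    -- list.
    have key : ∀ o, expectBest v id L (max x (outcomeValue v o)) ≤
        (V + max (x - V) 0 + T) + max ((outcomeValue v o : ℝ) - V) 0 := by
      intro o
      refine (ih _).trans ?_
      rcases le_total x (outcomeValue v o : ℝ) with h | h
      · rw [max_eq_right h]; linarith [le_max_right (x - V) 0]
      · rw [max_eq_left h]; linarith [le_max_right ((outcomeValue v o : ℝ) - V) 0]
    calc expectBest v id (l :: L) x
        ≤ ∑ o, outcomeProb l.1 o *
          ((V + max (x - V) 0 + T) + max ((outcomeValue v o : ℝ) - V) 0) :=
          Finset.sum_le_sum fun o _ => mul_le_mul_of_nonneg_left (key o) (hL l (by simp) o)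
      _ = _ := by
        rw [sum_outcomeProb_mul]
        have : max (-V) 0 = 0 := max_eq_right (by linarith)
        simp [outcomeValue, this, T]
        ring

theorem expectBest_singleton_zero (v : Fin n → ℝ≥0) (l : Lottery n) :
    expectBest v id [l] 0 = ∑ i, l.1 i * v i := by
  simp [expectBest, outcomeProb, outcomeValue]

/-- Adding a lottery that gives item `k` with probability at least `δ`. -/
theorem expectBest_cons_ge {v : Fin n → ℝ≥0} {l : Lottery n} {L : List (Lottery n)}
    (hl : Valid l) (hL : ∀ l ∈ L, Valid l) {δ : ℝ} {k : Fin n} (hk : δ ≤ l.1 k) :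
    expectBest v id L 0 + δ * max (v k - expectBest v id L 0) 0 ≤ expectBest v id (l :: L) 0 := by
  set y := expectBest v id L 0
  have hmono := expectBest_monotone (v := v) monotone_id hL
  have hy : ∀ o, y ≤ expectBest v id L (max 0 (outcomeValue v o)) := fun o => hmono (le_max_left _ _)
  have hyk : y + max (v k - y) 0 ≤ expectBest v id L (max 0 (outcomeValue v (some k))) := by
    have h1 := le_expectBest (v := v) hL (max 0 (outcomeValue v (some k)))
    have h2 : (v k : ℝ) ≤ max 0 (outcomeValue v (some k) : ℝ) := le_max_right _ _
    rcases le_total (v k - y) 0 with h | h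
    · rw [max_eq_right h]; linarith [hy (some k)]
    · rw [max_eq_left h]; linarith
  have : ∑ o, outcomeProb l.1 o * y + outcomeProb l.1 (some k) * max (v k - y) 0 ≤
      expectBest v id (l :: L) 0 := by
    have e : outcomeProb l.1 (some k) * max (v k - y) 0 =
        ∑ o, if o = some k then outcomeProb l.1 o * max (v k - y) 0 else 0 := by simp
    rw [e, ← Finset.sum_add_distrib]
    refine Finset.sum_le_sum fun o _ => ?_
    split_ifs with h
    · subst h
      rw [← mul_add]
      exact mul_le_mul_of_nonneg_left hyk (hl _)
    · rw [add_zero]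
      exact mul_le_mul_of_nonneg_left (hy o) (hl _)
  rw [← Finset.sum_mul, sum_outcomeProb, one_mul] at this
  have h3 : δ * max (v k - y) 0 ≤ outcomeProb l.1 (some k) * max (v k - y) 0 :=
    mul_le_mul_of_nonneg_right hk (le_max_right _ _)
  linarith

/-- Each further copy multiplies the remaining gap between v k and the current value by at most 1 -
δ. -/
theorem expectBest_replicate_ge {v : Fin n → ℝ≥0} {l : Lottery n} {L : List (Lottery n)}
    (hl : Valid l) (hL : ∀ l ∈ L, Valid l) {δ : ℝ} (hδ1 : δ ≤ 1) {k : Fin n}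
    (hk : δ ≤ l.1 k) (m : ℕ) :
    v k - (1 - δ) ^ m * max (v k - expectBest v id L 0) 0 ≤
      expectBest v id (List.replicate m l ++ L) 0 := by
  induction m with
  | zero => simpa using by linarith [le_max_left (v k - expectBest v id L 0) 0]
  | succ m ih =>
    have hL' : ∀ l' ∈ List.replicate m l ++ L, Valid l' := by
      intro l' h
      rcases List.mem_append.1 h with h | h
      · rw [List.eq_of_mem_replicate h]; exact hl
      · exact hL _ h
    have h := expectBest_cons_ge (v := v) hl hL' hk
    rw [List.replicate_succ, List.cons_append]
    set y := expectBest v id (List.replicate m l ++ L) 0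
    set E := max (v k - expectBest v id L 0) 0
    have h2 : v k - y ≤ (1 - δ) ^ m * E := by linarith
    have h3 : (1 - δ) * (v k - y) ≤ (1 - δ) * ((1 - δ) ^ m * E) :=
      mul_le_mul_of_nonneg_left h2 (by linarith)
    rw [pow_succ']
    by_cases h4 : 0 ≤ v k - y
    · rw [max_eq_left h4] at h
      linarith
    · have h5 : (0:ℝ) ≤ (1 - δ) * ((1 - δ) ^ m * E) :=
        mul_nonneg (by linarith) (mul_nonneg (pow_nonneg (by linarith) _) (le_max_right _ _))
      rw [max_eq_right (by linarith)] at h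
      linarith

/-- Adding a lottery to one that exceeds `V` with probability at most `1/3`. -/
theorem expectBest_pair_ge {v : Fin n → ℝ≥0} {l l' : Lottery n} (hl : Valid l) (hl' : Valid l')
    {V : ℝ} (hV : 0 ≤ V)
    (hp : ∑ i, (if V < v i then l.1 i else 0) ≤ 1 / 3) :
    ∑ i, l.1 i * v i + 2 / 3 * ∑ i, l'.1 i * max ((v i : ℝ) - V) 0 ≤
      expectBest v id [l', l] 0 := by
  have hmass : 2 / 3 ≤ ∑ a, outcomeProb l.1 a *
      (if (outcomeValue v a : ℝ) ≤ V then 1 else 0) := by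
    rw [sum_outcomeProb_mul]
    have e : ∑ i, l.1 i * ((if (outcomeValue v (some i) : ℝ) ≤ V then (1:ℝ) else 0) -
        (if (outcomeValue v none : ℝ) ≤ V then 1 else 0)) =
        - ∑ i, (if V < v i then l.1 i else 0) := by
      rw [← Finset.sum_neg_distrib]
      refine Finset.sum_congr rfl fun i _ => ?_
      by_cases h : (v i : ℝ) ≤ V
      · simp [outcomeValue, h, hV, not_lt.2 h]
      · simp [outcomeValue, h, hV, not_le.1 h]
    rw [e]
    simp [outcomeValue, hV]
    norm_num at hp ⊢
    linarith
  -- With x already drawn from `l'`, the outcome of `l` is at most V with probability at least 2/3,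
  -- and then x improves on it by at least (x - V)^+.
  have hF : ∀ x : ℝ, 0 ≤ x → ∑ i, l.1 i * v i + 2 / 3 * max (x - V) 0 ≤
      expectBest v id [l] x := by
    intro x hx
    have e : ∑ i, l.1 i * (v i : ℝ) = ∑ a, outcomeProb l.1 a * (outcomeValue v a : ℝ) := by
      rw [sum_outcomeProb_mul]; simp [outcomeValue]
    have h1 : 2 / 3 * max (x - V) 0 ≤ (∑ a, outcomeProb l.1 a *
      (if (outcomeValue v a : ℝ) ≤ V then 1 else 0)) * max (x - V) 0 :=
      mul_le_mul_of_nonneg_right hmass (le_max_right _ _)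
    refine (add_le_add_right h1 _).trans ?_
    rw [e, Finset.sum_mul, ← Finset.sum_add_distrib]
    refine Finset.sum_le_sum fun a _ => ?_
    rw [mul_assoc, ← mul_add]
    refine mul_le_mul_of_nonneg_left ?_ (hl a)
    simp only [expectBest, id]
    split_ifs with h
    · rw [one_mul]
      rcases le_total (x - V) 0 with h' | h'
      · rw [max_eq_right h', add_zero]; exact le_max_right _ _
      · rw [max_eq_left h']; exact le_trans (by linarith) (le_max_left _ _)
    · simp
  calc ∑ i, l.1 i * v i + 2 / 3 * ∑ i, l'.1 i * max ((v i : ℝ) - V) 0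
      = ∑ o, outcomeProb l'.1 o * (∑ i, l.1 i * v i +
          2 / 3 * max ((outcomeValue v o : ℝ) - V) 0) := by
        rw [sum_outcomeProb_mul]
        have : max (-V) 0 = 0 := max_eq_right (by linarith)
        simp [outcomeValue, this, Finset.mul_sum]
        exact Finset.sum_congr rfl fun i _ => by ring
    _ ≤ _ := Finset.sum_le_sum fun o _ => mul_le_mul_of_nonneg_left
        (by simpa using hF (outcomeValue v o) (NNReal.coe_nonneg _)) (hl' o)

/-- Adding a lottery to a list of expected value at least `V`. -/
theorem expectBest_cons_ge_excess {v : Fin n → ℝ≥0} {l : Lottery n} {L : List (Lottery n)}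
    (hl : Valid l) (hL : ∀ l ∈ L, Valid l) {V : ℝ} (hV0 : 0 ≤ V)
    (hV : V ≤ expectBest v id L 0) :
    V + ∑ i, l.1 i * max ((v i : ℝ) - V) 0 ≤ expectBest v id (l :: L) 0 := by
  have e : V + ∑ i, l.1 i * max ((v i : ℝ) - V) 0 =
      ∑ o, outcomeProb l.1 o * (V + max ((outcomeValue v o : ℝ) - V) 0) := by
    rw [sum_outcomeProb_mul]
    have : max (-V) 0 = 0 := max_eq_right (by linarith)
    simp [outcomeValue, this]
  rw [e]
  refine Finset.sum_le_sum fun o _ => mul_le_mul_of_nonneg_left ?_ (hl o)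
  -- For each outcome of `l` there are two lower bounds, the expected value of L (at least V) and
  -- the value just drawn; the larger one is used.
  have h1 := expectBest_monotone (v := v) monotone_id hL (le_max_left 0 (outcomeValue v o : ℝ))
  have h2 := (le_max_right 0 (outcomeValue v o : ℝ)).trans
    (le_expectBest (v := v) hL (max 0 (outcomeValue v o)))
  rcases le_total ((outcomeValue v o : ℝ) - V) 0 with h | h
  · rw [max_eq_right h]; linarith
  · rw [max_eq_left h]; linarith

/-! ### Bundles as lists, and a threshold bound on utility. -/

theorem sum_best_eq_expectBest (v : Fin n → ℝ≥0) {m : ℕ} (b : Fin m → Lottery n) {x : ℝ}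
    (hx : 0 ≤ x) :
    ∑ o : Fin m → Option (Fin n), (∏ j, outcomeProb (b j).1 (o j)) *
      max x ((Finset.univ.sup fun j => outcomeValue v (o j) : ℝ≥0) : ℝ) =
    expectBest v id (List.ofFn b) x := by
  induction m generalizing x with
  | zero => simp [expectBest, hx]
  | succ m ih =>
    rw [List.ofFn_succ, expectBest, ← (Fin.consEquiv fun _ => Option (Fin n)).sum_comp,
      Fintype.sum_prod_type]
    refine Finset.sum_congr rfl fun o _ => ?_
    rw [← ih (fun i => b i.succ) (le_max_of_le_left hx), Finset.mul_sum]
    refine Finset.sum_congr rfl fun o' _ => ?_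
    rw [Fin.prod_univ_succ, Fin.univ_succ, Finset.sup_cons, Finset.sup_map]
    simp only [Fin.consEquiv, Equiv.coe_fn_mk, Fin.cons_zero, Fin.cons_succ, mul_assoc]
    congr 2
    rw [max_assoc]
    rfl

theorem bundleValue_eq (v : Fin n → ℝ≥0) {m : ℕ} (b : Fin m → Lottery n) :
    bundleValue v b = expectBest v id (List.ofFn b) 0 := by
  rw [← sum_best_eq_expectBest v b le_rfl, bundleValue]
  simp

theorem bundlePrice_eq {m : ℕ} (b : Fin m → Lottery n) :
    bundlePrice b = listPrice (List.ofFn b) := by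
  simp [bundlePrice, listPrice, List.sum_ofFn]

/-- Utility of a list of lotteries. -/
noncomputable def listUtility (v : Fin n → ℝ≥0) (L : List (Lottery n)) : ℝ :=
  expectBest v id L 0 - listPrice L

theorem bundleUtility_eq (v : Fin n → ℝ≥0) {m : ℕ} (b : Fin m → Lottery n) :
    bundleUtility v b = listUtility v (List.ofFn b) := by
  rw [bundleUtility, bundleValue_eq, bundlePrice_eq, listUtility]

theorem IsOptimalBundle.listUtility_le {S : Set (Lottery n)} {v : Fin n → ℝ≥0} {m : ℕ}
    {b : Fin m → Lottery n} (hb : IsOptimalBundle S v b) {L : List (Lottery n)}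
    (hL : ∀ l ∈ L, l ∈ S) : listUtility v L ≤ bundleUtility v b := by
  have h := hb.2 L.length L.get fun j => hL _ (List.get_mem _ _)
  rwa [bundleUtility_eq, List.ofFn_get] at h

/-- If no single lottery has an expected excess over `V` above its price, no bundle has utility
above `V`. -/
theorem bundleUtility_le {S : Set (Lottery n)} (hS : ∀ l ∈ S, Valid l) {v : Fin n → ℝ≥0}
    {V : ℝ} (hV : 0 ≤ V) (h : ∀ l ∈ S, ∑ i, l.1 i * max ((v i : ℝ) - V) 0 ≤ l.2) {m : ℕ}
    {b : Fin m → Lottery n} (hb : ∀ j, b j ∈ S) : bundleUtility v b ≤ V := by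
  have hb' : ∀ l ∈ List.ofFn b, l ∈ S := by
    intro l hl
    obtain ⟨j, rfl⟩ := (List.mem_ofFn' _ _).1 hl
    exact hb j
  have h1 := expectBest_le (v := v) hV (fun l hl => hS l (hb' l hl)) 0
  have h2 : ((List.ofFn b).map fun l => ∑ i, l.1 i * max ((v i : ℝ) - V) 0).sum ≤
      listPrice (List.ofFn b) := List.sum_le_sum fun l hl => h l (hb' l hl)
  have h3 : max (0 - V) 0 = 0 := max_eq_right (by linarith)
  rw [bundleUtility_eq, listUtility]
  linarith

/-! ### Compactness and existence of optimal bundles. -/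

theorem IsLotterySystem.isCompact_inter {S : Set (Lottery n)} (hS : IsLotterySystem S) (M : ℝ) :
    IsCompact (S ∩ {l | l.2 ≤ M}) := by
  have hK : IsCompact ((Set.Icc 0 1 : Set (Fin n → ℝ)) ×ˢ Set.Icc (0:ℝ) M) :=
    isCompact_Icc.prod isCompact_Icc
  refine hK.of_isClosed_subset
    (hS.isClosed.inter (isClosed_le continuous_snd continuous_const)) ?_
  rintro l ⟨hl, hM⟩
  refine ⟨⟨fun i => hS.prob_nonneg l hl i, fun i => ?_⟩, (hS.price_pos l hl).le, hM⟩
  exact (Finset.single_le_sum (fun j _ => hS.prob_nonneg l hl j) (Finset.mem_univ i)).trans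
    (hS.prob_sum_le_one l hl)

/-- Closedness is local and every point has a neighbourhood of bounded price. This reduces
closedness of the systems constructed below to compact slices. -/
theorem isClosed_of_forall_inter {T : Set (Lottery n)}
    (h : ∀ M : ℝ, IsClosed (T ∩ {l | l.2 ≤ M})) : IsClosed T := by
  refine isClosed_of_closure_subset fun x hx => ?_
  have hU : IsOpen {l : Lottery n | l.2 < x.2 + 1} := isOpen_lt continuous_snd continuous_const
  have h1 : x ∈ closure (T ∩ {l | l.2 < x.2 + 1}) := by
    have := hU.inter_closure (t := T) ⟨by simp, hx⟩
    rwa [Set.inter_comm] at this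
  have h2 := closure_mono (Set.inter_subset_inter_right T
    (show {l : Lottery n | l.2 < x.2 + 1} ⊆ {l | l.2 ≤ x.2 + 1} from
      fun l (hl : l.2 < x.2 + 1) => hl.le)) h1
  rw [(h (x.2 + 1)).closure_eq] at h2
  exact h2.1

/-- The lotteries of price at most 1 form a compact set, on which the positive price attains its
minimum. A positive lower bound limits the size of affordable bundles. -/
theorem IsLotterySystem.exists_price_lower_bound {S : Set (Lottery n)} (hS : IsLotterySystem S) :
    ∃ ε > 0, ∀ l ∈ S, ε ≤ l.2 := by
  rcases (S ∩ {l | l.2 ≤ 1}).eq_empty_or_nonempty with h | h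
  · refine ⟨1, one_pos, fun l hl => ?_⟩
    by_contra! h'
    exact (h.subset ⟨hl, h'.le⟩ : l ∈ (∅ : Set _))
  · obtain ⟨l₀, h₀, hmin⟩ := (hS.isCompact_inter 1).exists_isMinOn h continuous_snd.continuousOn
    refine ⟨l₀.2, hS.price_pos _ h₀.1, fun l hl => ?_⟩
    rcases le_total l.2 1 with h' | h'
    · exact hmin ⟨hl, h'⟩
    · exact le_trans h₀.2 h'

theorem continuous_outcomeProb (o : Option (Fin n)) :
    Continuous fun φ : Fin n → ℝ => outcomeProb φ o := by
  cases o <;> simp only [outcomeProb] <;> fun_prop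

theorem continuous_outcomeValue (o : Option (Fin n)) :
    Continuous fun v : Fin n → ℝ≥0 => outcomeValue v o := by
  cases o <;> simp only [outcomeValue] <;> fun_prop

theorem continuous_bundleUtility_left {m : ℕ} (b : Fin m → Lottery n) :
    Continuous fun v => bundleUtility v b := by
  refine .sub (continuous_finsetSum _ fun o _ => continuous_const.mul ?_) continuous_const
  exact NNReal.continuous_coe.comp
    (Continuous.finset_sup_apply fun j _ => continuous_outcomeValue (o j))

theorem continuous_bundlePrice {m : ℕ} :
    Continuous fun b : Fin m → Lottery n => bundlePrice b :=
  continuous_finsetSum _ fun j _ => continuous_snd.comp (continuous_apply j)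

theorem continuous_bundleUtility_right (v : Fin n → ℝ≥0) {m : ℕ} :
    Continuous fun b : Fin m → Lottery n => bundleUtility v b := by
  refine .sub (continuous_finsetSum _ fun o _ => .mul ?_ continuous_const)
    continuous_bundlePrice
  exact continuous_finsetProd _ fun j _ => (continuous_outcomeProb (o j)).comp
    (continuous_fst.comp (continuous_apply j))

theorem bundleUtility_empty (v : Fin n → ℝ≥0) (b : Fin 0 → Lottery n) :
    bundleUtility v b = 0 := by
  simp [bundleUtility_eq, listUtility, expectBest, listPrice]

/-- With the threshold at the highest value of all items, every excess vanishes. -/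
theorem bundleUtility_le_sub {v : Fin n → ℝ≥0} {m : ℕ} {b : Fin m → Lottery n}
    (hb : ∀ j, Valid (b j)) :
    bundleUtility v b ≤ (Finset.univ.sup v : ℝ≥0) - bundlePrice b := by
  set V : ℝ := ((Finset.univ.sup v : ℝ≥0) : ℝ)
  have hV : ∀ i, (v i : ℝ) ≤ V := fun i => NNReal.coe_le_coe.2 (Finset.le_sup (Finset.mem_univ i))
  have hV0 : 0 ≤ V := NNReal.coe_nonneg _
  have hb' : ∀ l ∈ List.ofFn b, Valid l := by
    intro l hl
    obtain ⟨j, rfl⟩ := (List.mem_ofFn' _ _).1 hl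
    exact hb j
  have h := expectBest_le (v := v) hV0 hb' 0
  have h0 : ∀ i, max ((v i : ℝ) - V) 0 = 0 := fun i => max_eq_right (by linarith [hV i])
  have h1 : max (0 - V) 0 = 0 := max_eq_right (by linarith)
  simp only [h0, h1, mul_zero, Finset.sum_const_zero, List.map_const', List.sum_replicate,
    smul_zero, add_zero] at h
  rw [bundleUtility, bundleValue_eq]
  linarith

/-- A utility-maximizing bundle exists, and among these there is a most expensive one. -/
theorem IsLotterySystem.exists_isOptimalBundle {S : Set (Lottery n)} (hS : IsLotterySystem S)
    (v : Fin n → ℝ≥0) :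
    ∃ (m : ℕ) (b : Fin m → Lottery n), IsOptimalBundle S v b ∧
      ∀ (m' : ℕ) (b' : Fin m' → Lottery n), IsOptimalBundle S v b' →
        bundlePrice b' ≤ bundlePrice b := by
  obtain ⟨ε, hε, hεS⟩ := hS.exists_price_lower_bound
  set V : ℝ := ((Finset.univ.sup v : ℝ≥0) : ℝ)
  obtain ⟨N, hN⟩ := exists_nat_ge (V / ε)
  let K : (m : ℕ) → Set (Fin m → Lottery n) := fun m => Set.univ.pi fun _ => S ∩ {l | l.2 ≤ V}
  have hK : ∀ m, IsCompact (K m) := fun m => isCompact_univ_pi fun _ => hS.isCompact_inter V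
  -- Bundles of nonnegative utility have total price at most V, hence at most V/ε members, each of
  -- price at most V. Their (utility, price) pairs lie in this compact set, on which utility and
  -- then price are maximized.
  let D : Set (ℝ × ℝ) := ⋃ m ∈ Finset.range (N + 1),
    (fun b : Fin m → Lottery n => (bundleUtility v b, bundlePrice b)) '' K m
  have hD : IsCompact D := Finset.isCompact_biUnion _ fun m _ =>
    (hK m).image ((continuous_bundleUtility_right v).prodMk continuous_bundlePrice)
  have hmem : ∀ (m : ℕ) (b : Fin m → Lottery n), (∀ j, b j ∈ S) → 0 ≤ bundleUtility v b →
      (bundleUtility v b, bundlePrice b) ∈ D := by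
    intro m b hb h0
    have h1 := bundleUtility_le_sub (v := v) fun j => hS.valid (hb j)
    have hp : bundlePrice b ≤ V := by linarith
    have hm : m * ε ≤ V := by
      refine le_trans ?_ hp
      calc (m:ℝ) * ε = ∑ _j : Fin m, ε := by simp
        _ ≤ _ := Finset.sum_le_sum fun j _ => hεS _ (hb j)
    have hmN : m < N + 1 := by
      have : (m:ℝ) ≤ N := ((le_div_iff₀ hε).2 hm).trans hN
      exact Nat.lt_succ_of_le (by exact_mod_cast this)
    refine Set.mem_biUnion (Finset.mem_coe.2 (Finset.mem_range.2 hmN))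
      ⟨b, fun j _ => ⟨hb j, ?_⟩, rfl⟩
    exact (Finset.single_le_sum (f := fun j => (b j).2)
      (fun j _ => (hS.price_pos _ (hb j)).le) (Finset.mem_univ j)).trans hp
  have hback : ∀ x ∈ D, ∃ (m : ℕ) (b : Fin m → Lottery n), (∀ j, b j ∈ S) ∧
      (bundleUtility v b, bundlePrice b) = x := by
    intro x hx
    simp only [D, Set.mem_iUnion] at hx
    obtain ⟨m, _, b, hb, rfl⟩ := hx
    exact ⟨m, b, fun j => (hb j trivial).1, rfl⟩
  have h0 : ((0:ℝ), (0:ℝ)) ∈ D := by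
    have := hmem 0 Fin.elim0 (fun j => j.elim0) (bundleUtility_empty v _).ge
    simpa [bundleUtility_empty, bundlePrice] using this
  obtain ⟨x, hx, hxmax⟩ := hD.exists_isMaxOn ⟨_, h0⟩ continuous_fst.continuousOn
  have hD' : IsCompact (D ∩ {y | y.1 = x.1}) :=
    hD.inter_right (isClosed_eq continuous_fst continuous_const)
  obtain ⟨y, ⟨hy, hyx⟩, hymax⟩ := hD'.exists_isMaxOn ⟨x, hx, rfl⟩ continuous_snd.continuousOn
  obtain ⟨m, b, hb, rfl⟩ := hback y hy
  have hx0 : 0 ≤ x.1 := hxmax h0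
  replace hyx : bundleUtility v b = x.1 := hyx
  have hmax : ∀ (m' : ℕ) (b' : Fin m' → Lottery n), (∀ j, b' j ∈ S) →
      bundleUtility v b' ≤ bundleUtility v b := by
    intro m' b' hb'
    rw [hyx]
    rcases le_total 0 (bundleUtility v b') with h | h
    · exact hxmax (hmem m' b' hb' h)
    · exact h.trans hx0
  refine ⟨m, b, ⟨hb, hmax⟩, fun m' b' hb' => ?_⟩
  have he : bundleUtility v b' = x.1 := by
    rw [← hyx]; exact le_antisymm (hmax m' b' hb'.1) (hb'.2 m b hb)
  exact hymax ⟨hmem m' b' hb'.1 (he ▸ hx0), he⟩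

theorem IsLotterySystem.exists_payment_eq {S : Set (Lottery n)} (hS : IsLotterySystem S)
    (v : Fin n → ℝ≥0) :
    ∃ (m : ℕ) (b : Fin m → Lottery n), IsOptimalBundle S v b ∧
      payment S v = ENNReal.ofReal (bundlePrice b) := by
  obtain ⟨m, b, hb, h⟩ := hS.exists_isOptimalBundle v
  refine ⟨m, b, hb, le_antisymm ?_ ?_⟩
  · exact iSup₂_le fun m' b' => iSup_le fun hb' => ENNReal.ofReal_le_ofReal (h m' b' hb')
  · exact le_iSup₂_of_le m b (le_iSup_of_le hb le_rfl)

theorem IsOptimalBundle.ofReal_le_payment {S : Set (Lottery n)} {v : Fin n → ℝ≥0} {m : ℕ}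
    {b : Fin m → Lottery n} (hb : IsOptimalBundle S v b) :
    ENNReal.ofReal (bundlePrice b) ≤ payment S v :=
  le_iSup₂_of_le m b (le_iSup_of_le hb le_rfl)

theorem IsLotterySystem.payment_le {S : Set (Lottery n)} (hS : IsLotterySystem S)
    (v : Fin n → ℝ≥0) : payment S v ≤ (Finset.univ.sup v : ℝ≥0) := by
  obtain ⟨m, b, hb, h⟩ := hS.exists_payment_eq v
  rw [h]
  refine ENNReal.ofReal_le_of_le_toReal ?_
  have h1 := bundleUtility_le_sub (v := v) fun j => hS.valid (hb.1 j)
  have h2 := hb.2 0 Fin.elim0 fun j => j.elim0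
  rw [bundleUtility_empty] at h2
  rw [ENNReal.coe_toReal]
  linarith

/-! ### Replacing bundles by single lotteries -/

/-- The lottery that draws from both `l` and `l'` and keeps the outcome chosen by `c`. -/
noncomputable def combine (c : Option (Fin n) → Option (Fin n) → Option (Fin n))
    (l l' : Lottery n) : Lottery n :=
  (fun i => ∑ a, ∑ b, if c a b = some i then outcomeProb l.1 a * outcomeProb l'.1 b else 0,
    l.2 + l'.2)

theorem outcomeProb_combine (c : Option (Fin n) → Option (Fin n) → Option (Fin n))
    (l l' : Lottery n) (o : Option (Fin n)) :
    outcomeProb (combine c l l').1 o =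
      ∑ a, ∑ b, if c a b = o then outcomeProb l.1 a * outcomeProb l'.1 b else 0 := by
  cases o with
  | some i => rfl
  | none =>
    -- The outcome `none` is handled through the total mass, since its probability is defined as the
    -- complement of the others.
    have h1 : ∑ o : Option (Fin n), ∑ a, ∑ b,
        (if c a b = o then outcomeProb l.1 a * outcomeProb l'.1 b else 0) = 1 := by
      calc _ = ∑ a, ∑ b, ∑ o : Option (Fin n),
            (if c a b = o then outcomeProb l.1 a * outcomeProb l'.1 b else 0) := by
            rw [Finset.sum_comm]
            exact Finset.sum_congr rfl fun a _ => Finset.sum_comm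
        _ = ∑ a, ∑ b, outcomeProb l.1 a * outcomeProb l'.1 b := by
            simp only [Finset.sum_ite_eq, Finset.mem_univ, if_true]
        _ = 1 := by simp only [← Finset.mul_sum, sum_outcomeProb, mul_one]
    rw [Fintype.sum_option] at h1
    exact (eq_sub_of_add_eq h1).symm

theorem sum_outcomeProb_combine (c : Option (Fin n) → Option (Fin n) → Option (Fin n))
    (l l' : Lottery n) (g : Option (Fin n) → ℝ) :
    ∑ o, outcomeProb (combine c l l').1 o * g o =
      ∑ a, outcomeProb l.1 a * ∑ b, outcomeProb l'.1 b * g (c a b) := by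
  simp_rw [outcomeProb_combine, Finset.sum_mul, Finset.mul_sum]
  rw [Finset.sum_comm]
  refine Finset.sum_congr rfl fun a _ => ?_
  rw [Finset.sum_comm]
  refine Finset.sum_congr rfl fun b _ => ?_
  simp [ite_mul, mul_assoc]

theorem Valid.combine {c : Option (Fin n) → Option (Fin n) → Option (Fin n)}
    {l l' : Lottery n} (hl : Valid l) (hl' : Valid l') : Valid (combine c l l') := by
  intro o
  rw [outcomeProb_combine]
  refine Finset.sum_nonneg fun a _ => Finset.sum_nonneg fun b _ => ?_
  split_ifs
  · exact mul_nonneg (hl a) (hl' b)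
  · exact le_rfl

theorem isLotterySystem_of_valid {S : Set (Lottery n)} (hc : IsClosed S)
    (hv : ∀ l ∈ S, Valid l) (hp : ∀ l ∈ S, 0 < l.2) : IsLotterySystem S where
  isClosed := hc
  prob_nonneg l hl i := hv l hl (some i)
  prob_sum_le_one l hl := sub_nonneg.1 (hv l hl none)
  price_pos := hp

theorem continuous_combine (c : Option (Fin n) → Option (Fin n) → Option (Fin n)) :
    Continuous fun x : Lottery n × Lottery n => combine c x.1 x.2 := by
  refine .prodMk (continuous_pi fun i => continuous_finsetSum _ fun a _ =>
    continuous_finsetSum _ fun b _ => ?_) (by fun_prop)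
  split_ifs
  · exact ((continuous_outcomeProb a).comp (by fun_prop)).mul
      ((continuous_outcomeProb b).comp (by fun_prop))
  · exact continuous_const

/-- Prices add and are positive, so a combined lottery of price at most M comes from two lotteries
of price at most M, that is, from a compact set. -/
theorem IsLotterySystem.image2_combine {S T : Set (Lottery n)} (hS : IsLotterySystem S)
    (hT : IsLotterySystem T) (c : Option (Fin n) → Option (Fin n) → Option (Fin n)) :
    IsLotterySystem (Set.image2 (combine c) S T) := by
  refine isLotterySystem_of_valid (isClosed_of_forall_inter fun M => ?_) ?_ ?_
  · have e : Set.image2 (BuyMany.combine c) S T ∩ {l | l.2 ≤ M} =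
        ((fun x : Lottery n × Lottery n => BuyMany.combine c x.1 x.2) ''
          ((S ∩ {l | l.2 ≤ M}) ×ˢ (T ∩ {l | l.2 ≤ M}))) ∩ {l | l.2 ≤ M} := by
      ext x
      constructor
      · rintro ⟨⟨l, hl, l', hl', rfl⟩, hM⟩
        have h1 := hS.price_pos l hl
        have h2 := hT.price_pos l' hl'
        have h3 : l.2 + l'.2 ≤ M := hM
        exact ⟨⟨(l, l'), ⟨⟨hl, show l.2 ≤ M by linarith⟩, ⟨hl', show l'.2 ≤ M by linarith⟩⟩, rfl⟩,
          hM⟩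
      · rintro ⟨⟨⟨l, l'⟩, ⟨hl, hl'⟩, rfl⟩, hM⟩
        exact ⟨⟨l, hl.1, l', hl'.1, rfl⟩, hM⟩
    rw [e]
    exact (((hS.isCompact_inter M).prod (hT.isCompact_inter M)).image
      (continuous_combine c)).isClosed.inter (isClosed_le continuous_snd continuous_const)
  · rintro _ ⟨l, hl, l', hl', rfl⟩
    exact (hS.valid hl).combine (hT.valid hl')
  · rintro _ ⟨l, hl, l', hl', rfl⟩
    exact add_pos (hS.price_pos l hl) (hT.price_pos l' hl')

/-- The choice functions that keep one of the two outcomes. -/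
def choices (n : ℕ) : Set (Option (Fin n) → Option (Fin n) → Option (Fin n)) :=
  {c | ∀ a b, c a b = a ∨ c a b = b}

/-- Single lotteries simulating the bundles of size `m + 1`. -/
noncomputable def combined (S : Set (Lottery n)) : ℕ → Set (Lottery n)
  | 0 => S
  | m + 1 => ⋃ c ∈ choices n, Set.image2 (combine c) S (combined S m)

theorem IsLotterySystem.combined {S : Set (Lottery n)} (hS : IsLotterySystem S) (m : ℕ) :
    IsLotterySystem (combined S m) := by
  induction m with
  | zero => exact hS
  | succ m ih =>
    have h := fun c => hS.image2_combine ih c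
    refine ⟨(Set.toFinite (choices n)).isClosed_biUnion fun c _ => (h c).isClosed, ?_, ?_, ?_⟩ <;>
      intro l hl <;> simp only [BuyMany.combined, Set.mem_iUnion] at hl <;>
      obtain ⟨c, -, hl⟩ := hl
    exacts [(h c).prob_nonneg l hl, (h c).prob_sum_le_one l hl, (h c).price_pos l hl]

theorem combined_price_ge {S : Set (Lottery n)} {ε : ℝ} (hε : ∀ l ∈ S, ε ≤ l.2) {m : ℕ}
    {l : Lottery n} (hl : l ∈ combined S m) : (m + 1) * ε ≤ l.2 := by
  induction m generalizing l with
  | zero => simpa using hε l hl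
  | succ m ih =>
    simp only [combined, Set.mem_iUnion] at hl
    obtain ⟨c, -, l₁, h₁, l₂, h₂, rfl⟩ := hl
    have h3 := hε l₁ h₁
    have h4 := ih h₂
    simp only [combine]
    push_cast
    linarith

theorem IsLotterySystem.iUnion_combined {S : Set (Lottery n)} (hS : IsLotterySystem S) :
    IsLotterySystem (⋃ m, BuyMany.combined S m) := by
  obtain ⟨ε, hε, hεS⟩ := hS.exists_price_lower_bound
  have h := hS.combined
  refine ⟨isClosed_of_forall_inter fun M => ?_, ?_, ?_, ?_⟩
  -- A simulated bundle of size m + 1 costs at least (m + 1) ε, so only finitely many m matter below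
  -- price M.
  · obtain ⟨N, hN⟩ := exists_nat_ge (M / ε)
    have e : (⋃ m, BuyMany.combined S m) ∩ {l | l.2 ≤ M} =
        (⋃ m ∈ Finset.range N, BuyMany.combined S m) ∩ {l | l.2 ≤ M} := by
      ext l
      constructor
      · rintro ⟨hl, hM⟩
        obtain ⟨m, hm⟩ := Set.mem_iUnion.1 hl
        refine ⟨Set.mem_biUnion (Finset.mem_coe.2 (Finset.mem_range.2 ?_)) hm, hM⟩
        have h1 := (combined_price_ge hεS hm).trans hM
        have : ((m:ℝ) + 1) ≤ N := ((le_div_iff₀ hε).2 h1).trans hN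
        exact_mod_cast this
      · rintro ⟨hl, hM⟩
        obtain ⟨m, -, hm⟩ := Set.mem_iUnion₂.1 hl
        exact ⟨Set.mem_iUnion.2 ⟨m, hm⟩, hM⟩
    rw [e]
    exact ((Finset.range N).finite_toSet.isClosed_biUnion fun m _ => (h m).isClosed).inter
      (isClosed_le continuous_snd continuous_const)
  all_goals
    intro l hl
    obtain ⟨m, hl⟩ := Set.mem_iUnion.1 hl
  exacts [(h m).prob_nonneg l hl, (h m).prob_sum_le_one l hl, (h m).price_pos l hl]

theorem outcomeValue_choice_le (v : Fin n → ℝ≥0)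
    {c : Option (Fin n) → Option (Fin n) → Option (Fin n)} (hc : c ∈ choices n)
    (a b : Option (Fin n)) (x : ℝ) :
    max x (outcomeValue v (c a b) : ℝ) ≤ max (max x (outcomeValue v a)) (outcomeValue v b) := by
  rcases hc a b with h | h <;> rw [h]
  · exact le_max_left _ _
  · exact max_le_max_right _ (le_max_left _ _)

/-- A combined lottery is dominated by the bundle it simulates. -/
theorem exists_list_of_mem_combined {S : Set (Lottery n)} (hS : IsLotterySystem S) {m : ℕ}
    {l : Lottery n} (hl : l ∈ combined S m) (v : Fin n → ℝ≥0) :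
    ∃ L : List (Lottery n), (∀ l ∈ L, l ∈ S) ∧ listPrice L = l.2 ∧
      ∀ h : ℝ → ℝ, Monotone h → ∀ x, expectBest v h [l] x ≤ expectBest v h L x := by
  induction m generalizing l with
  | zero => exact ⟨[l], fun l' h => List.mem_singleton.1 h ▸ hl, by simp [listPrice],
      fun h _ x => le_rfl⟩
  | succ m ih =>
    simp only [combined, Set.mem_iUnion] at hl
    obtain ⟨c, hc, l₁, h₁, l₂, h₂, rfl⟩ := hl
    obtain ⟨L, hLS, hLp, hL⟩ := ih h₂
    refine ⟨l₁ :: L, List.forall_mem_cons.2 ⟨h₁, hLS⟩, by simpa [listPrice, combine] using hLp,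
      fun h hh x => ?_⟩
    simp only [expectBest]
    rw [sum_outcomeProb_combine c l₁ l₂ fun o => h (max x (outcomeValue v o))]
    refine Finset.sum_le_sum fun a _ => mul_le_mul_of_nonneg_left ?_ (hS.valid h₁ a)
    refine le_trans (Finset.sum_le_sum fun b _ => mul_le_mul_of_nonneg_left ?_
      -- The induction hypothesis is used at the starting value raised by the outcome of `l₁`.
      ((hS.combined m).valid h₂ b)) (hL h hh _)
    exact hh (outcomeValue_choice_le v hc a b x)

theorem exists_list_of_list_combined {S : Set (Lottery n)} (hS : IsLotterySystem S)
    (v : Fin n → ℝ≥0) {L : List (Lottery n)} (hL : ∀ l ∈ L, l ∈ ⋃ m, combined S m) :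
    ∃ L' : List (Lottery n), (∀ l ∈ L', l ∈ S) ∧ listPrice L' = listPrice L ∧
      ∀ x, expectBest v id L x ≤ expectBest v id L' x := by
  induction L with
  | nil => exact ⟨[], by simp, rfl, fun _ => le_rfl⟩
  | cons l L ih =>
    obtain ⟨L', hS', hp', h'⟩ := ih fun l hl => hL l (by simp [hl])
    obtain ⟨m, hm⟩ := Set.mem_iUnion.1 (hL l (by simp))
    obtain ⟨L₁, hS₁, hp₁, h₁⟩ := exists_list_of_mem_combined hS hm v
    have hval : ∀ l ∈ L', Valid l := fun l hl => hS.valid (hS' l hl)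
    refine ⟨L₁ ++ L', ?_, ?_, fun x => ?_⟩
    · intro l hl
      rcases List.mem_append.1 hl with h | h
      exacts [hS₁ l h, hS' l h]
    · simp only [listPrice, List.map_append, List.sum_append, List.map_cons, List.sum_cons] at *
      rw [hp₁, hp']
    · rw [expectBest_append]
      refine le_trans ?_ (h₁ _ (expectBest_monotone monotone_id hval) x)
      exact Finset.sum_le_sum fun o _ => mul_le_mul_of_nonneg_left (h' _)
        ((hS.combined m).valid hm o)

/-- The choice that keeps an outcome of higher value. -/
noncomputable def bestChoice (v : Fin n → ℝ≥0) (a b : Option (Fin n)) : Option (Fin n) :=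
  if outcomeValue v b ≤ outcomeValue v a then a else b

theorem bestChoice_mem (v : Fin n → ℝ≥0) : bestChoice v ∈ choices n := by
  intro a b
  unfold bestChoice
  split_ifs <;> simp

theorem outcomeValue_bestChoice (v : Fin n → ℝ≥0) (a b : Option (Fin n)) :
    (outcomeValue v (bestChoice v a b) : ℝ) = max (outcomeValue v a : ℝ) (outcomeValue v b) := by
  unfold bestChoice
  split_ifs with h
  · rw [max_eq_left (by exact_mod_cast h)]
  · rw [max_eq_right (by exact_mod_cast (not_le.1 h).le)]

/-- The rule that keeps the outcome v prefers turns the bundle into one lottery with no loss. The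
rule depends on v, which is why `combined` contains all choice rules. -/
theorem exists_combined_of_list {S : Set (Lottery n)} (v : Fin n → ℝ≥0) (L : List (Lottery n))
    {l : Lottery n} (hl : l ∈ S) (hL : ∀ l ∈ L, l ∈ S) :
    ∃ l' ∈ combined S L.length, l'.2 = listPrice (l :: L) ∧
      ∀ x, expectBest v id [l'] x = expectBest v id (l :: L) x := by
  induction L generalizing l with
  | nil => exact ⟨l, hl, by simp [listPrice], fun x => rfl⟩
  | cons l₁ L ih =>
    obtain ⟨l₂, h₂, hp, h⟩ := ih (hL l₁ (by simp)) fun l hl => hL l (by simp [hl])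
    refine ⟨combine (bestChoice v) l l₂, ?_, ?_, fun x => ?_⟩
    · exact Set.mem_biUnion (bestChoice_mem v) ⟨l, hl, l₂, h₂, rfl⟩
    · simp only [combine, hp, listPrice, List.map_cons, List.sum_cons]
    · rw [expectBest]
      simp only [expectBest]
      rw [sum_outcomeProb_combine (bestChoice v) l l₂ fun o => id (max x (outcomeValue v o))]
      refine Finset.sum_congr rfl fun a _ => ?_
      congr 1
      have := h (max x (outcomeValue v a))
      simp only [expectBest] at this
      rw [← this]
      refine Finset.sum_congr rfl fun b _ => ?_
      rw [outcomeValue_bestChoice, max_assoc]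

theorem listUtility_singleton_bundle (v : Fin n → ℝ≥0) (l : Lottery n) :
    bundleUtility v ![l] = listUtility v [l] := by
  rw [bundleUtility_eq]; simp

/-- Every lottery system is contained in one in which every type buys at most one lottery and pays
the same. -/
theorem IsLotterySystem.exists_buysSingle {S : Set (Lottery n)} (hS : IsLotterySystem S) :
    ∃ S' : Set (Lottery n), IsLotterySystem S' ∧ S ⊆ S' ∧
      ∀ v : Fin n → ℝ≥0, BuysSingle S' v ∧ payment S' v = payment S v := by
  refine ⟨⋃ m, BuyMany.combined S m, hS.iUnion_combined, Set.subset_iUnion (BuyMany.combined S) 0,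
    fun v => ?_⟩
  set S' := ⋃ m, BuyMany.combined S m
  have hSS' : S ⊆ S' := Set.subset_iUnion (BuyMany.combined S) 0
  -- Bundles from the larger system are matched, at equal price and no smaller utility, by bundles
  -- from `S`. Hence the maximal utility and the payment do not change.
  have hsim : ∀ {m : ℕ} (b : Fin m → Lottery n), (∀ j, b j ∈ S') →
      ∃ (m' : ℕ) (b' : Fin m' → Lottery n), (∀ j, b' j ∈ S) ∧
        bundlePrice b' = bundlePrice b ∧ bundleUtility v b ≤ bundleUtility v b' := by
    intro m b hb
    obtain ⟨L', h1, h2, h3⟩ := exists_list_of_list_combined hS v (L := List.ofFn b) (by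
      intro l hl
      obtain ⟨j, rfl⟩ := (List.mem_ofFn' _ _).1 hl
      exact hb j)
    refine ⟨L'.length, L'.get, fun j => h1 _ (List.get_mem _ _), ?_, ?_⟩
    · rw [bundlePrice_eq, bundlePrice_eq, List.ofFn_get, h2]
    · rw [bundleUtility_eq, bundleUtility_eq, List.ofFn_get, listUtility, listUtility, h2]
      linarith [h3 0]
  have hup : ∀ {m : ℕ} {b : Fin m → Lottery n}, IsOptimalBundle S v b →
      IsOptimalBundle S' v b := by
    intro m b hb
    refine ⟨fun j => hSS' (hb.1 j), fun m' b' hb' => ?_⟩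
    obtain ⟨m₁, b₁, h1, -, h3⟩ := hsim b' hb'
    exact h3.trans (hb.2 _ b₁ h1)
  have hpay : payment S' v = payment S v := by
    refine le_antisymm ?_ ?_
    · refine iSup₂_le fun m b => iSup_le fun hb => ?_
      obtain ⟨m₁, b₁, h1, h2, h3⟩ := hsim b hb.1
      rw [← h2]
      exact IsOptimalBundle.ofReal_le_payment
        ⟨h1, fun m' b' hb' => (hb.2 m' b' fun j => hSS' (hb' j)).trans h3⟩
    · exact iSup₂_le fun m b => iSup_le fun hb => (hup hb).ofReal_le_payment
  refine ⟨?_, hpay⟩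
  obtain ⟨m, b, hb, hbp⟩ := hS.exists_payment_eq v
  -- The empty bundle is separate because `combined` simulates only nonempty bundles.
  rcases h : List.ofFn b with _ | ⟨l, L⟩
  · have hm : m = 0 := by simpa using congrArg List.length h
    exact ⟨m, b, by omega, hup hb, by rw [hpay, hbp]⟩
  · have hmem : ∀ l' ∈ l :: L, l' ∈ S := by
      intro l' hl
      rw [← h] at hl
      obtain ⟨j, rfl⟩ := (List.mem_ofFn' _ _).1 hl
      exact hb.1 j
    obtain ⟨l', hl', hp, hval⟩ := exists_combined_of_list v L (hmem l (by simp))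
      fun l hl => hmem l (by simp [hl])
    have hu : bundleUtility v ![l'] = bundleUtility v b := by
      rw [listUtility_singleton_bundle, bundleUtility_eq, h, listUtility, listUtility, hval, ← hp]
      simp [listPrice]
    refine ⟨1, ![l'], le_rfl, ⟨?_, ?_⟩, ?_⟩
    · intro j
      rw [Subsingleton.elim j 0]
      exact Set.mem_iUnion.2 ⟨_, hl'⟩
    · rw [hu]
      exact (hup hb).2
    · rw [hpay, hbp, bundlePrice_eq b, h, ← hp]
      simp [bundlePrice]

/-! ### Base prices and the surplus at scaled prices. -/

theorem IsLotterySystem.exists_basePrice_eq {S : Set (Lottery n)} (hS : IsLotterySystem S)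
    {i : Fin n} (h : basePrice S i ≠ ∞) :
    ∃ l ∈ S, 1 / (130 * (n : ℝ) ^ 3) ≤ l.1 i ∧ basePrice S i = ENNReal.ofReal l.2 := by
  set T := S ∩ {l : Lottery n | 1 / (130 * (n : ℝ) ^ 3) ≤ l.1 i} with hT
  obtain ⟨l₀, h₀⟩ : T.Nonempty := by
    by_contra hne
    apply h
    simp only [basePrice, iInf_eq_top]
    intro l hl
    exact absurd ⟨l, hl⟩ hne
  have hc : IsCompact (T ∩ {l | l.2 ≤ l₀.2}) := by
    have e : T ∩ {l | l.2 ≤ l₀.2} = (S ∩ {l | l.2 ≤ l₀.2}) ∩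
        {l : Lottery n | 1 / (130 * (n : ℝ) ^ 3) ≤ l.1 i} := by
      rw [hT]; ext; simp only [Set.mem_inter_iff]; tauto
    rw [e]
    exact (hS.isCompact_inter _).inter_right (isClosed_le continuous_const
      ((continuous_apply i).comp continuous_fst))
  obtain ⟨l, hl, hmin⟩ := hc.exists_isMinOn ⟨l₀, h₀, le_refl l₀.2⟩ continuous_snd.continuousOn
  refine ⟨l, hl.1.1, hl.1.2, le_antisymm (iInf₂_le l hl.1) (le_iInf₂ fun l' hl' => ?_)⟩
  refine ENNReal.ofReal_le_ofReal ?_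
  rcases le_total l'.2 l₀.2 with h' | h'
  · exact hmin ⟨hl', h'⟩
  · exact le_trans hl.2 h'

theorem IsLotterySystem.basePrice_pos {S : Set (Lottery n)} (hS : IsLotterySystem S)
    (i : Fin n) : 0 < basePrice S i := by
  by_cases h : basePrice S i = ∞
  · simp [h]
  · obtain ⟨l, hl, -, e⟩ := hS.exists_basePrice_eq h
    rw [e]
    exact ENNReal.ofReal_pos.2 (hS.price_pos l hl)

/-- The item prices `p` multiplied by `s`. -/
noncomputable def scaled (p : Fin n → ℝ≥0∞) (s : ℝ) : Fin n → ℝ≥0∞ :=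
  fun i => ENNReal.ofReal s * p i

/-- Utility of type `v` under the item prices `p` scaled by `s`. -/
noncomputable def surplus (p : Fin n → ℝ≥0∞) (v : Fin n → ℝ≥0) (s : ℝ) : ℝ :=
  (Finset.univ.sup fun i => ((v i : ℝ≥0∞) - scaled p s i).toNNReal : ℝ≥0)

theorem itemPayment_le (q : Fin n → ℝ≥0∞) (v : Fin n → ℝ≥0) :
    itemPayment q v ≤ (Finset.univ.sup v : ℝ≥0) :=
  iSup₂_le fun i hi => hi.1.trans (ENNReal.coe_le_coe.2 (Finset.le_sup (Finset.mem_univ i)))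

theorem itemPayment_ne_top (q : Fin n → ℝ≥0∞) (v : Fin n → ℝ≥0) : itemPayment q v ≠ ∞ :=
  ne_top_of_le_ne_top ENNReal.coe_ne_top (itemPayment_le q v)

/-- Payment of type `v` under the item prices `p` scaled by `s`, as a real number. -/
noncomputable def scaledPay (p : Fin n → ℝ≥0∞) (v : Fin n → ℝ≥0) (s : ℝ) : ℝ :=
  (itemPayment (scaled p s) v).toReal

theorem scaledPay_nonneg (p : Fin n → ℝ≥0∞) (v : Fin n → ℝ≥0) (s : ℝ) : 0 ≤ scaledPay p v s :=
  ENNReal.toReal_nonneg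

theorem ofReal_scaledPay (p : Fin n → ℝ≥0∞) (v : Fin n → ℝ≥0) (s : ℝ) :
    ENNReal.ofReal (scaledPay p v s) = itemPayment (scaled p s) v :=
  ENNReal.ofReal_toReal (itemPayment_ne_top _ _)

theorem surplus_nonneg (p : Fin n → ℝ≥0∞) (v : Fin n → ℝ≥0) (s : ℝ) : 0 ≤ surplus p v s :=
  NNReal.coe_nonneg _

theorem sub_scaled_toReal {p : Fin n → ℝ≥0∞} {v : Fin n → ℝ≥0} {s : ℝ} (hs : 0 ≤ s) {i : Fin n}
    (hi : p i ≠ ∞) : (((v i : ℝ≥0∞) - scaled p s i).toNNReal : ℝ) =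
      max (v i - s * (p i).toReal) 0 := by
  rw [scaled, ← ENNReal.ofReal_toReal hi, ← ENNReal.ofReal_mul hs]
  rw [ENNReal.toReal_ofReal ENNReal.toReal_nonneg]
  rw [ENNReal.ofReal, ← ENNReal.coe_sub, ENNReal.toNNReal_coe, NNReal.coe_sub_def,
    Real.coe_toNNReal _ (mul_nonneg hs ENNReal.toReal_nonneg)]

theorem sub_le_surplus {p : Fin n → ℝ≥0∞} {v : Fin n → ℝ≥0} {s : ℝ} (hs : 0 ≤ s) {i : Fin n}
    (hi : p i ≠ ∞) : v i - s * (p i).toReal ≤ surplus p v s := by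
  refine (le_max_left _ 0).trans ?_
  rw [← sub_scaled_toReal hs hi]
  exact NNReal.coe_le_coe.2
    (Finset.le_sup (f := fun i => ((v i : ℝ≥0∞) - scaled p s i).toNNReal) (Finset.mem_univ i))

/-- If the surplus is positive, it is attained at an item that the type may buy. -/
theorem surplus_eq_zero_or [NeZero n] (p : Fin n → ℝ≥0∞) (v : Fin n → ℝ≥0) {s : ℝ} (hs : 0 < s) :
    surplus p v s = 0 ∨ ∃ k, p k ≠ ∞ ∧ surplus p v s = v k - s * (p k).toReal ∧
      s * (p k).toReal ≤ scaledPay p v s := by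
  rcases (surplus_nonneg p v s).eq_or_lt with h | h
  · exact Or.inl h.symm
  right
  obtain ⟨k, -, hk⟩ := Finset.exists_mem_eq_sup Finset.univ Finset.univ_nonempty
    fun i => ((v i : ℝ≥0∞) - scaled p s i).toNNReal
  have hk' : surplus p v s = ((v k : ℝ≥0∞) - scaled p s k).toNNReal := by rw [surplus, hk]
  have hfin : p k ≠ ∞ := by
    intro hp
    rw [hk', scaled, hp, ENNReal.mul_top (ENNReal.ofReal_pos.2 hs).ne'] at h
    simp at h
  rw [sub_scaled_toReal hs.le hfin] at hk'
  have hpos : 0 < v k - s * (p k).toReal := by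
    by_contra! hc
    rw [hk', max_eq_right hc] at h
    exact lt_irrefl _ h
  rw [max_eq_left hpos.le] at hk'
  have hq : ∀ i, p i ≠ ∞ → scaled p s i = ENNReal.ofReal (s * (p i).toReal) := by
    intro i hi
    rw [ENNReal.ofReal_mul hs.le, ENNReal.ofReal_toReal hi, scaled]
  have hv : ∀ i, (v i : ℝ≥0∞) = ENNReal.ofReal (v i) := fun i => by simp
  have hbest : IsBestItem (scaled p s) v k := by
    refine ⟨?_, fun j => ?_⟩
    · rw [hq k hfin, hv]
      exact ENNReal.ofReal_le_ofReal (by linarith)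
    · by_cases hj : p j = ∞
      · simp [scaled, hj, ENNReal.mul_top (ENNReal.ofReal_pos.2 hs).ne']
      · have h1 := sub_le_surplus (v := v) hs.le hj
        rw [hq k hfin, hq j hj, hv, hv, ← ENNReal.ofReal_add (by positivity) (by positivity),
          ← ENNReal.ofReal_add (by positivity) (by positivity)]
        exact ENNReal.ofReal_le_ofReal (by linarith)
  refine ⟨k, hfin, hk', ?_⟩
  rw [scaledPay]
  refine (ENNReal.ofReal_le_iff_le_toReal (itemPayment_ne_top _ _)).1 ?_
  rw [← hq k hfin]
  exact le_iSup₂_of_le k hbest le_rfl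

theorem surplus_anti [NeZero n] (p : Fin n → ℝ≥0∞) (v : Fin n → ℝ≥0) {s s' : ℝ} (hs : 0 < s)
    (h : s ≤ s') : surplus p v s' ≤ surplus p v s := by
  rcases surplus_eq_zero_or p v (hs.trans_le h) with h0 | ⟨k, hk, e, -⟩
  · rw [h0]; exact surplus_nonneg _ _ _
  · rw [e]
    refine le_trans ?_ (sub_le_surplus hs.le hk)
    have := mul_le_mul_of_nonneg_right h (ENNReal.toReal_nonneg (a := p k))
    linarith

/-- The item bought at scale s can also be bought at scale s', where it costs s'/s times as much. -/
theorem surplus_le_add [NeZero n] (p : Fin n → ℝ≥0∞) (v : Fin n → ℝ≥0) {s s' : ℝ} (hs : 0 < s)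
    (hs' : 0 < s') : surplus p v s ≤ surplus p v s' + s' / s * scaledPay p v s := by
  have hpay := scaledPay_nonneg p v s
  rcases surplus_eq_zero_or p v hs with h0 | ⟨k, hk, e, h1⟩
  · rw [h0]
    have := surplus_nonneg p v s'
    positivity
  · have h2 := sub_le_surplus (v := v) hs'.le hk
    have h3 := mul_le_mul_of_nonneg_left h1 (div_pos hs' hs).le
    have h4 : s' / s * (s * (p k).toReal) = s' * (p k).toReal := by field_simp
    have h5 : 0 ≤ s * (p k).toReal := by positivity
    rw [e]
    linarith

theorem surplus_half_le [NeZero n] (p : Fin n → ℝ≥0∞) (v : Fin n → ℝ≥0) (T : ℕ) :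
    surplus p v (1 / 2) ≤ surplus p v ((2:ℝ) ^ ((T : ℤ) - 1)) +
      2 * ∑ j ∈ Finset.range T, scaledPay p v ((2:ℝ) ^ ((j : ℤ) - 1)) := by
  induction T with
  | zero => simp
  | succ T ih =>
    have h := surplus_le_add p v (s := (2:ℝ) ^ ((T : ℤ) - 1)) (s' := (2:ℝ) ^ (((T + 1 : ℕ) : ℤ) - 1))
      (by positivity) (by positivity)
    have e : (2:ℝ) ^ (((T + 1 : ℕ) : ℤ) - 1) / (2:ℝ) ^ ((T : ℤ) - 1) = 2 := by
      rw [← zpow_sub₀ two_ne_zero]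
      push_cast
      norm_num
    rw [e] at h
    rw [Finset.sum_range_succ]
    linarith

/-- The first scale beyond the range of the algorithm. -/
noncomputable def topScale (n : ℕ) : ℝ := 130 * (n : ℝ) ^ 3 * Real.exp 1 ^ 5

theorem one_le_cast [NeZero n] : (1:ℝ) ≤ n := by
  exact_mod_cast NeZero.one_le

theorem exp_five_bounds : 140 ≤ Real.exp 1 ^ 5 ∧ Real.exp 1 ^ 5 ≤ 149 := by
  have h1 := Real.exp_one_gt_d9
  have h2 := Real.exp_one_lt_d9
  constructor
  · calc (140:ℝ) ≤ 2.7182 ^ 5 := by norm_num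
      _ ≤ _ := by gcongr; linarith
  · calc Real.exp 1 ^ 5 ≤ 2.7183 ^ 5 := by gcongr; linarith
      _ ≤ _ := by norm_num

theorem topScale_ge [NeZero n] : 18200 ≤ topScale n := by
  have h1 := one_le_cast (n := n)
  have h2 := exp_five_bounds.1
  calc (18200:ℝ) = 130 * 1 ^ 3 * 140 := by norm_num
    _ ≤ _ := by unfold topScale; gcongr

theorem cube_le_two_zpow [NeZero n] :
    64 * (n:ℝ) ^ 3 ≤ (2:ℝ) ^ (((3 * Nat.log 2 n + 10 : ℕ) : ℤ) - 1) := by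
  have h : n < 2 ^ (Nat.log 2 n + 1) := Nat.lt_pow_succ_log_self one_lt_two n
  have h' : (n:ℝ) ≤ 2 ^ (Nat.log 2 n + 1) := by exact_mod_cast h.le
  have e : (((3 * Nat.log 2 n + 10 : ℕ) : ℤ) - 1) = ((3 * (Nat.log 2 n + 1) + 6 : ℕ) : ℤ) := by
    push_cast; ring
  rw [e, zpow_natCast, pow_add, mul_comm 3, pow_mul]
  have : (n:ℝ) ^ 3 ≤ (2 ^ (Nat.log 2 n + 1)) ^ 3 := by gcongr
  linarith

/-- The surplus lost up to `topScale` is collected by the scales of the algorithm. -/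
theorem surplus_sub_le [NeZero n] (p : Fin n → ℝ≥0∞) (v : Fin n → ℝ≥0) :
    surplus p v (1 / 2) - surplus p v (topScale n) ≤
      310 * ∑ j ∈ Finset.range (3 * Nat.log 2 n + 11), scaledPay p v ((2:ℝ) ^ ((j : ℤ) - 1)) := by
  set T := 3 * Nat.log 2 n + 10 with hT
  have h1 := surplus_half_le p v T
  have htop : 0 < topScale n := by linarith [topScale_ge (n := n)]
  have h2 := surplus_le_add p v (s := (2:ℝ) ^ ((T : ℤ) - 1)) (by positivity) htop
  -- The scale 2^(T-1) is the highest of the first branch and is at least 64 n^3; the ratio is then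
  -- at most 130 · 149 / 64 < 310.
  have h3 : topScale n / (2:ℝ) ^ ((T : ℤ) - 1) ≤ 310 := by
    rw [div_le_iff₀ (by positivity)]
    have h4 := cube_le_two_zpow (n := n)
    have h5 := exp_five_bounds.2
    have h6 : 0 < (n:ℝ) ^ 3 := by have := one_le_cast (n := n); positivity
    calc topScale n ≤ 130 * (n:ℝ) ^ 3 * 149 := by unfold topScale; gcongr
      _ ≤ 310 * (64 * (n:ℝ) ^ 3) := by linarith
      _ ≤ _ := by gcongr
  have h7 := mul_le_mul_of_nonneg_right h3 (scaledPay_nonneg p v ((2:ℝ) ^ ((T : ℤ) - 1)))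
  have h8 : 0 ≤ ∑ j ∈ Finset.range T, scaledPay p v ((2:ℝ) ^ ((j : ℤ) - 1)) :=
    Finset.sum_nonneg fun j _ => scaledPay_nonneg _ _ _
  rw [show 3 * Nat.log 2 n + 11 = T + 1 from rfl, Finset.sum_range_succ]
  linarith

/-- Base prices are positive and there are finitely many items, so at a high enough scale nothing is
worth buying. This starts the recursion for the imitating bundle. -/
theorem exists_surplus_eq_zero [NeZero n] {p : Fin n → ℝ≥0∞} (hp : ∀ i, 0 < p i)
    (v : Fin n → ℝ≥0) {s : ℝ} (hs : 0 < s) : ∃ d : ℕ, surplus p v (s * Real.exp 1 ^ d) = 0 := by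
  have ht : Filter.Tendsto (fun d : ℕ => s * Real.exp 1 ^ d) Filter.atTop Filter.atTop :=
    (tendsto_pow_atTop_atTop_of_one_lt (Real.one_lt_exp_iff.2 one_pos)).const_mul_atTop hs
  have h : ∀ i, ∀ᶠ d : ℕ in Filter.atTop, p i ≠ ∞ →
      (v i : ℝ) ≤ s * Real.exp 1 ^ d * (p i).toReal := by
    intro i
    by_cases hi : p i = ∞
    · simp [hi]
    · filter_upwards [(ht.atTop_mul_const (ENNReal.toReal_pos (hp i).ne' hi)).eventually_ge_atTop
        (v i : ℝ)] with d hd _ using hd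
  obtain ⟨d, hd⟩ := (Filter.eventually_all.2 h).exists
  refine ⟨d, ?_⟩
  rcases surplus_eq_zero_or p v (s := s * Real.exp 1 ^ d) (by positivity) with h0 | ⟨k, hk, e, -⟩
  · exact h0
  · refine le_antisymm ?_ (surplus_nonneg _ _ _)
    rw [e]
    linarith [hd k hk]

/-! ### Bundles that imitate the surplus, and the threshold of a buyer. -/

theorem listPrice_append (L L' : List (Lottery n)) :
    listPrice (L ++ L') = listPrice L + listPrice L' := by
  simp [listPrice]

/-- A bundle whose value is at least the surplus at scale `s`: buy, for a geometric sequence of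
scales, many copies of the cheapest lottery for the item bought at that scale. -/
theorem IsLotterySystem.exists_list_surplus_le [NeZero n] {S : Set (Lottery n)}
    (hS : IsLotterySystem S) (v : Fin n → ℝ≥0) (d : ℕ) {s : ℝ} (hs : 0 < s)
    (h0 : surplus (basePrice S) v (s * Real.exp 1 ^ d) = 0) :
    ∃ L : List (Lottery n), (∀ l ∈ L, l ∈ S) ∧
      surplus (basePrice S) v s ≤ expectBest v id L 0 ∧
      listPrice L ≤ ∑ i ∈ Finset.range d, 130 * (n:ℝ) ^ 3 / (s * Real.exp 1 ^ i) *
        scaledPay (basePrice S) v (s * Real.exp 1 ^ i) := by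
  induction d generalizing s with
  | zero => exact ⟨[], by simp, by simpa [expectBest] using h0.le, by simp [listPrice]⟩
  | succ d ih =>
    obtain ⟨L, hLS, hval, hprice⟩ := ih (s := s * Real.exp 1) (by positivity)
      (by rwa [mul_assoc, ← pow_succ'])
    have hL : ∀ l ∈ L, Valid l := fun l hl => hS.valid (hLS l hl)
    have hn := one_le_cast (n := n)
    have hpay := scaledPay_nonneg (basePrice S) v s
    rw [Finset.sum_range_succ']
    simp only [mul_assoc s (Real.exp 1), ← pow_succ'] at hprice
    simp only [pow_zero, mul_one]
    rcases surplus_eq_zero_or (basePrice S) v hs with h | ⟨k, hk, e, hkpay⟩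
    · refine ⟨L, hLS, h ▸ le_expectBest hL 0, hprice.trans (le_add_of_nonneg_right ?_)⟩
      positivity
    obtain ⟨l, hl, hlk, hlp⟩ := hS.exists_basePrice_eq hk
    have hlp' : (basePrice S k).toReal = l.2 := by
      rw [hlp, ENNReal.toReal_ofReal (hS.price_pos l hl).le]
    -- The number of copies is the reciprocal of the probability guaranteed by the base price.
    refine ⟨List.replicate (130 * n ^ 3) l ++ L, ?_, ?_, ?_⟩
    · intro l' h
      rcases List.mem_append.1 h with h | h
      · rwa [List.eq_of_mem_replicate h]
      · exact hLS _ h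
    · have hN : (1:ℝ) ≤ 130 * (n:ℝ) ^ 3 := by nlinarith [one_le_pow₀ hn (n := 3)]
      have h1 := expectBest_replicate_ge (v := v) (hS.valid hl) hL
        ((div_le_one (by linarith)).2 hN) hlk (130 * n ^ 3)
      have h2 : (1 - 1 / (130 * (n:ℝ) ^ 3)) ^ (130 * n ^ 3) ≤ Real.exp (-1) := by
        have := Real.one_sub_div_pow_le_exp_neg (n := 130 * n ^ 3) (t := 1) (by exact_mod_cast hN)
        simpa using this
      refine le_trans ?_ h1
      -- L is already worth w(es) ≥ v k - e s p k, so the gap to v k is at most e s p k. The miss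
      -- probability 1/e reduces it to s p k, leaving v k - s p k = w(s).
      have h3 : max (v k - expectBest v id L 0) 0 ≤ s * Real.exp 1 * (basePrice S k).toReal := by
        refine max_le ?_ (by positivity)
        have := sub_le_surplus (v := v) (s := s * Real.exp 1) (by positivity) hk
        linarith
      have h4 : (1 - 1 / (130 * (n:ℝ) ^ 3)) ^ (130 * n ^ 3) *
          max (v k - expectBest v id L 0) 0 ≤
          Real.exp (-1) * (s * Real.exp 1 * (basePrice S k).toReal) :=
        mul_le_mul h2 h3 (le_max_right _ _) (Real.exp_pos _).le
      have h5 : Real.exp (-1) * (s * Real.exp 1 * (basePrice S k).toReal) =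
          s * (basePrice S k).toReal := by
        rw [Real.exp_neg]; field_simp
      rw [e]
      linarith
    · rw [listPrice_append]
      have h1 : listPrice (List.replicate (130 * n ^ 3) l) =
          130 * (n:ℝ) ^ 3 / s * (s * (basePrice S k).toReal) := by
        rw [hlp']
        simp [listPrice]
        field_simp
      have h2 : 130 * (n:ℝ) ^ 3 / s * (s * (basePrice S k).toReal) ≤
          130 * (n:ℝ) ^ 3 / s * scaledPay (basePrice S) v s :=
        mul_le_mul_of_nonneg_left hkpay (by positivity)
      linarith

/-- The part of the value of a lottery that exceeds `V` and is obtained with small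
probabilities. -/
noncomputable def smallExcess (v : Fin n → ℝ≥0) (V : ℝ) (φ : Fin n → ℝ) : ℝ :=
  ∑ i, min (φ i) (1 / (130 * (n:ℝ) ^ 3)) * max ((v i : ℝ) - V) 0

/-- The structure of a type that buys the single lottery `l`: `V` is the highest value of an item
whose base price is at most the price paid. -/
theorem IsLotterySystem.exists_threshold [NeZero n] {S : Set (Lottery n)}
    (hS : IsLotterySystem S) {v : Fin n → ℝ≥0} {l : Lottery n} (hl : l ∈ S)
    (hopt : ∀ L : List (Lottery n), (∀ l ∈ L, l ∈ S) → listUtility v L ≤ listUtility v [l]) :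
    ∃ V : ℝ, 0 ≤ V ∧ (V = 0 ∨ ∃ k, basePrice S k ≤ ENNReal.ofReal l.2 ∧ V = v k) ∧
      V ≤ surplus (basePrice S) v (1 / 2) + l.2 / 2 ∧
      (∀ l' ∈ S, ∑ i, l'.1 i * max ((v i : ℝ) - V) 0 ≤ 3 / 2 * l'.2) ∧
      ∃ d : ℕ, l.2 / 2 ≤ surplus (basePrice S) v (1 / 2) - surplus (basePrice S) v (topScale n) +
        smallExcess v V l.1 + ∑ i ∈ Finset.range d, 130 * (n:ℝ) ^ 3 /
          (topScale n * Real.exp 1 ^ i) *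
            scaledPay (basePrice S) v (topScale n * Real.exp 1 ^ i) := by
  classical
  set W : ℝ≥0 := Finset.univ.sup fun i => if basePrice S i ≤ ENNReal.ofReal l.2 then v i else 0
  have hB : ∀ i, basePrice S i ≤ ENNReal.ofReal l.2 → (v i : ℝ) ≤ W := by
    intro i hi
    have := Finset.le_sup (f := fun i => if basePrice S i ≤ ENNReal.ofReal l.2 then v i else 0)
      (Finset.mem_univ i)
    rw [if_pos hi] at this
    exact_mod_cast this
  have hW : (W : ℝ) = 0 ∨ ∃ k, basePrice S k ≤ ENNReal.ofReal l.2 ∧ (W : ℝ) = v k := by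
    obtain ⟨k, -, hk⟩ := Finset.exists_mem_eq_sup Finset.univ Finset.univ_nonempty
      fun i => if basePrice S i ≤ ENNReal.ofReal l.2 then v i else 0
    by_cases h : basePrice S k ≤ ENNReal.ofReal l.2
    · exact Or.inr ⟨k, h, by simp only [W, hk, if_pos h]⟩
    · exact Or.inl (by simp only [W, hk, if_neg h]; rfl)
  -- Were the probability of such an item at least 1/(130 n^3), `l` itself would be a candidate for
  -- its base price, putting its value below `W`.
  have hsmall : ∀ i, (W : ℝ) < v i → l.1 i < 1 / (130 * (n:ℝ) ^ 3) := by
    intro i hi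
    by_contra! hc
    exact absurd (hB i (iInf₂_le l ⟨hl, hc⟩)) (not_le.2 hi)
  have hn := one_le_cast (n := n)
  have hlp := hS.price_pos l hl
  have hprob : ∑ i, (if (W:ℝ) < v i then l.1 i else 0) ≤ 1 / 3 := by
    calc ∑ i, (if (W:ℝ) < v i then l.1 i else 0) ≤ ∑ _i : Fin n, 1 / (130 * (n:ℝ) ^ 3) := by
          refine Finset.sum_le_sum fun i _ => ?_
          split_ifs with h
          · exact (hsmall i h).le
          · positivity
      _ = n * (1 / (130 * (n:ℝ) ^ 3)) := by simp
      _ ≤ 1 / 3 := by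
          rw [mul_one_div, div_le_div_iff₀ (by positivity) (by norm_num)]
          nlinarith [one_le_pow₀ hn (n := 2)]
  have hW2 : (W:ℝ) ≤ surplus (basePrice S) v (1 / 2) + l.2 / 2 := by
    rcases hW with h | ⟨k, hk, h⟩
    · rw [h]
      have := surplus_nonneg (basePrice S) v (1 / 2)
      positivity
    · have hk' : basePrice S k ≠ ∞ := ne_top_of_le_ne_top ENNReal.ofReal_ne_top hk
      have h1 := sub_le_surplus (v := v) (s := 1 / 2) (by norm_num) hk'
      have h2 := ENNReal.toReal_le_of_le_ofReal hlp.le hk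
      rw [h]
      linarith
  have hval : listUtility v [l] = ∑ i, l.1 i * v i - l.2 := by
    rw [listUtility, expectBest_singleton_zero]; simp [listPrice]
  refine ⟨W, W.coe_nonneg, hW, hW2, fun l' hl' => ?_, ?_⟩
  -- Buying `l'` on top of `l` does not pay, yet it would gain at least 2/3 of its excess over `W`.
  · have h1 := hopt [l', l] (by simpa using ⟨hl', hl⟩)
    have h2 := expectBest_pair_ge (v := v) (hS.valid hl) (hS.valid hl') W.coe_nonneg hprob
    rw [hval, listUtility] at h1
    have h3 : listPrice [l', l] = l'.2 + l.2 := by simp [listPrice]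
    linarith
  · have htop : 0 < topScale n := by linarith [topScale_ge (n := n)]
    obtain ⟨d, hd⟩ := exists_surplus_eq_zero (fun i => hS.basePrice_pos i) v htop
    obtain ⟨L, hLS, hLval, hLprice⟩ := hS.exists_list_surplus_le v d htop hd
    refine ⟨d, ?_⟩
    have h1 := hopt L hLS
    rw [hval, listUtility] at h1
    -- The part of the value up to `W` contributes at most `W`, as the probabilities sum to at most
    -- 1; the rest is `smallExcess`.
    have h2 : ∑ i, l.1 i * (v i : ℝ) ≤ W + smallExcess v W l.1 := by
      have h3 : ∀ i, l.1 i * (v i : ℝ) ≤ l.1 i * W +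
          min (l.1 i) (1 / (130 * (n:ℝ) ^ 3)) * max ((v i : ℝ) - W) 0 := by
        intro i
        have h0 := hS.prob_nonneg l hl i
        rcases le_or_gt (v i : ℝ) W with h | h
        · rw [max_eq_right (by linarith), mul_zero, add_zero]
          exact mul_le_mul_of_nonneg_left h h0
        · rw [min_eq_left (hsmall i h).le, max_eq_left (by linarith)]
          linarith
      refine (Finset.sum_le_sum fun i _ => h3 i).trans ?_
      rw [Finset.sum_add_distrib, ← Finset.sum_mul]
      have := mul_le_mul_of_nonneg_right (hS.prob_sum_le_one l hl) W.coe_nonneg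
      unfold smallExcess
      linarith
    linarith

/-! ### Price scaling and the boosted competing system. -/

/-- The lottery system with all prices multiplied by `c`. -/
def priceScale (c : ℝ) (S : Set (Lottery n)) : Set (Lottery n) := {l | (l.1, l.2 / c) ∈ S}

theorem isLotterySystem_priceScale {S : Set (Lottery n)} (hS : IsLotterySystem S) {c : ℝ}
    (hc : 0 < c) : IsLotterySystem (priceScale c S) where
  isClosed := hS.isClosed.preimage
    (f := fun l : Lottery n => ((l.1, l.2 / c) : Lottery n)) (by fun_prop)
  prob_nonneg l hl := hS.prob_nonneg (l.1, l.2 / c) hl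
  prob_sum_le_one l hl := hS.prob_sum_le_one (l.1, l.2 / c) hl
  price_pos l hl := by
    have h : 0 < l.2 / c := hS.price_pos _ hl
    exact (div_pos_iff_of_pos_right hc).1 h

/-- The highest utility of type `v` from bundles of lotteries from `S`. -/
noncomputable def maxUtility (S : Set (Lottery n)) (v : Fin n → ℝ≥0) : ℝ≥0∞ :=
  ⨆ (m : ℕ) (b : Fin m → Lottery n) (_ : ∀ j, b j ∈ S), ENNReal.ofReal (bundleUtility v b)

/-- A supremum of continuous functions is lower semicontinuous, even over uncountably many bundles.
Differences of these utilities can therefore be integrated additively, with no measurability of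
payments. -/
theorem measurable_maxUtility (S : Set (Lottery n)) : Measurable (maxUtility S) := by
  refine LowerSemicontinuous.measurable ?_
  refine lowerSemicontinuous_iSup fun m => lowerSemicontinuous_iSup fun b =>
    lowerSemicontinuous_iSup fun _ => Continuous.lowerSemicontinuous ?_
  exact ENNReal.continuous_ofReal.comp (continuous_bundleUtility_left b)

theorem le_maxUtility {S : Set (Lottery n)} {v : Fin n → ℝ≥0} {L : List (Lottery n)}
    (hL : ∀ l ∈ L, l ∈ S) : ENNReal.ofReal (listUtility v L) ≤ maxUtility S v := by
  have e : listUtility v L = bundleUtility v L.get := by rw [bundleUtility_eq, List.ofFn_get]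
  rw [e]
  exact le_iSup₂_of_le L.length L.get
    (le_iSup_of_le (fun j => hL _ (List.get_mem _ _)) le_rfl)

/-- The utility lost when all prices double is at most the payment. -/
theorem IsLotterySystem.maxUtility_le {S : Set (Lottery n)} (hS : IsLotterySystem S)
    (v : Fin n → ℝ≥0) :
    maxUtility S v ≤ maxUtility (priceScale 2 S) v + payment S v := by
  obtain ⟨m, b, hb, hp⟩ := hS.exists_payment_eq v
  -- The optimal bundle at doubled prices has utility lower by exactly its original price.
  let b' : Fin m → Lottery n := fun j => ((b j).1, 2 * (b j).2)
  have hb' : ∀ j, b' j ∈ priceScale 2 S := by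
    intro j
    have : ((b j).1, 2 * (b j).2 / 2) = b j := by
      rw [mul_div_cancel_left₀ _ two_ne_zero]
    show ((b j).1, 2 * (b j).2 / 2) ∈ S
    rw [this]
    exact hb.1 j
  have h1 : bundleUtility v b = bundleUtility v b' + bundlePrice b := by
    have hval : bundleValue v b' = bundleValue v b := rfl
    have hpr : bundlePrice b' = 2 * bundlePrice b := by
      simp [bundlePrice, b', Finset.mul_sum]
    rw [bundleUtility, bundleUtility, hval, hpr]
    ring
  have h2 : maxUtility S v ≤ ENNReal.ofReal (bundleUtility v b) :=
    iSup₂_le fun m' c => iSup_le fun hc => ENNReal.ofReal_le_ofReal (hb.2 m' c hc)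
  refine h2.trans ?_
  rw [h1, hp]
  refine ENNReal.ofReal_add_le.trans (add_le_add_left ?_ _)
  exact le_iSup₂_of_le m b' (le_iSup_of_le hb' le_rfl)

/-- The competing system that boosts all small probabilities, and offers every item with certainty
at its base price. -/
def boosted (S : Set (Lottery n)) : Set (Lottery n) :=
  (fun l : Lottery n => ((fun i => 130 * (n:ℝ) ^ 2 * min (l.1 i) (1 / (130 * (n:ℝ) ^ 3)),
    130 * (n:ℝ) ^ 2 * (3 / 16) * l.2) : Lottery n)) '' S ∪
  (fun i => ((Pi.single i 1, (basePrice S i).toReal) : Lottery n)) '' {i | basePrice S i ≠ ∞}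

theorem valid_single (i : Fin n) (c : ℝ) : Valid ((Pi.single i 1, c) : Lottery n) := by
  intro o
  cases o with
  | none => simp [outcomeProb]
  | some j =>
    simp only [outcomeProb, Pi.single_apply]
    split_ifs <;> norm_num

theorem isLotterySystem_boosted [NeZero n] {S : Set (Lottery n)} (hS : IsLotterySystem S) :
    IsLotterySystem (boosted S) := by
  have hn := one_le_cast (n := n)
  have hc : 0 < 130 * (n:ℝ) ^ 2 * (3 / 16) := by positivity
  refine isLotterySystem_of_valid ?_ ?_ ?_
  · refine IsClosed.union (isClosed_of_forall_inter fun M => ?_)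
      ((Set.toFinite _).image _).isClosed
    set f : Lottery n → Lottery n :=
      fun l => ((fun i => 130 * (n:ℝ) ^ 2 * min (l.1 i) (1 / (130 * (n:ℝ) ^ 3)),
        130 * (n:ℝ) ^ 2 * (3 / 16) * l.2) : Lottery n)
    have hf : Continuous f := by fun_prop
    have e : f '' S ∩ {l | l.2 ≤ M} =
        f '' (S ∩ {l | l.2 ≤ M / (130 * (n:ℝ) ^ 2 * (3 / 16))}) := by
      ext x
      constructor
      · rintro ⟨⟨l, hl, rfl⟩, hM⟩
        exact ⟨l, ⟨hl, (le_div_iff₀' hc).2 hM⟩, rfl⟩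
      · rintro ⟨l, ⟨hl, hM⟩, rfl⟩
        exact ⟨⟨l, hl, rfl⟩, (le_div_iff₀' hc).1 hM⟩
    rw [e]
    exact ((hS.isCompact_inter _).image hf).isClosed
  · rintro _ (⟨l, hl, rfl⟩ | ⟨i, -, rfl⟩)
    · intro o
      cases o with
      | some i =>
        have h0 := hS.prob_nonneg l hl i
        simp only [outcomeProb]
        positivity
      | none =>
        simp only [outcomeProb, ← Finset.mul_sum]
        have h1 : ∑ i, min (l.1 i) (1 / (130 * (n:ℝ) ^ 3)) ≤
            ∑ _i : Fin n, 1 / (130 * (n:ℝ) ^ 3) :=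
          Finset.sum_le_sum fun i _ => min_le_right _ _
        have h2 := mul_le_mul_of_nonneg_left h1 (show 0 ≤ 130 * (n:ℝ) ^ 2 by positivity)
        -- The factor 130 n^2 is as large as possible: n probabilities capped at 1/(130 n^3) then
        -- sum to at most 1.
        have h3 : 130 * (n:ℝ) ^ 2 * ∑ _i : Fin n, 1 / (130 * (n:ℝ) ^ 3) = 1 := by
          simp
          field_simp
        linarith
    · exact valid_single _ _
  · rintro _ (⟨l, hl, rfl⟩ | ⟨i, hi, rfl⟩)
    · exact mul_pos hc (hS.price_pos l hl)
    · exact ENNReal.toReal_pos (hS.basePrice_pos i).ne' hi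

theorem sum_single_mul (i : Fin n) (g : Fin n → ℝ) :
    ∑ j, (Pi.single i (1:ℝ) : Fin n → ℝ) j * g j = g i := by
  simp [Pi.single_apply]

/-- A type with a large small-probability excess either loses much surplus between the lowest and
the highest scale, or is charged a lot by one of the scaled boosted systems. -/
theorem IsLotterySystem.boosted_alternative [NeZero n] {S : Set (Lottery n)}
    (hS : IsLotterySystem S) {v : Fin n → ℝ≥0} {l : Lottery n} (hl : l ∈ S) {V : ℝ} (hV : 0 ≤ V)
    (hVk : V = 0 ∨ ∃ k, basePrice S k ≤ ENNReal.ofReal l.2 ∧ V = v k)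
    (hex : ∀ l' ∈ S, ∑ i, l'.1 i * max ((v i : ℝ) - V) 0 ≤ 3 / 2 * l'.2)
    (hbig : 3 / 8 * l.2 ≤ smallExcess v V l.1) :
    l.2 ≤ surplus (basePrice S) v (1 / 2) - surplus (basePrice S) v (topScale n) ∨
      ENNReal.ofReal (15 * l.2) ≤
        maxUtility (boosted S) v - maxUtility (priceScale 8 (boosted S)) v := by
  have hn := one_le_cast (n := n)
  have hM : (130:ℝ) ≤ 130 * (n:ℝ) ^ 2 := by nlinarith [one_le_pow₀ hn (n := 2)]
  have hlp := hS.price_pos l hl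
  set M : ℝ := 130 * (n:ℝ) ^ 2 with hMdef
  -- The cheapest lottery for item k gives it with probability at least 1/(130 n^3), so the excess
  -- of v k over V is at most 130 n^3 · (3/2) p k, less than its price at `topScale`.
  have htopV : surplus (basePrice S) v (topScale n) ≤ V := by
    rcases surplus_eq_zero_or (basePrice S) v (s := topScale n)
      (by linarith [topScale_ge (n := n)]) with h | ⟨k, hk, e, -⟩
    · rw [h]; exact hV
    · obtain ⟨l', hl', hk', e'⟩ := hS.exists_basePrice_eq hk
      have h1 := hex l' hl'
      have hp' := hS.price_pos l' hl'
      rw [e, e', ENNReal.toReal_ofReal hp'.le]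
      have h2 : 1 / (130 * (n:ℝ) ^ 3) * max ((v k : ℝ) - V) 0 ≤
          ∑ i, l'.1 i * max ((v i : ℝ) - V) 0 :=
        (mul_le_mul_of_nonneg_right hk' (le_max_right _ _)).trans
          (Finset.single_le_sum (f := fun i => l'.1 i * max ((v i : ℝ) - V) 0)
            (fun i _ => mul_nonneg (hS.prob_nonneg l' hl' i) (le_max_right _ _))
            (Finset.mem_univ k))
      have h3 := h2.trans h1
      rw [one_div, inv_mul_le_iff₀ (by positivity)] at h3
      have h4 : 130 * (n:ℝ) ^ 3 * (3 / 2 * l'.2) ≤ topScale n * l'.2 := by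
        unfold topScale
        have h5 := exp_five_bounds.1
        have h6 : 0 ≤ 130 * (n:ℝ) ^ 3 * l'.2 := by positivity
        nlinarith [mul_le_mul_of_nonneg_left h5 h6]
      linarith [le_max_left ((v k : ℝ) - V) 0]
  -- If w(8) exceeds V + M P/16, where P = `l.2`, the surplus drop exceeds M P/16, and M ≥ 130 makes
  -- this more than P.
  rcases le_or_gt (surplus (basePrice S) v 8) (V + M * l.2 / 16) with hw | hw
  swap
  · left
    have h1 := surplus_anti (basePrice S) v (s := 1 / 2) (s' := 8) (by norm_num) (by norm_num)
    nlinarith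
  right
  set V' := max V (surplus (basePrice S) v 8)
  have hV' : V' ≤ V + M * l.2 / 16 := max_le (by linarith [mul_pos (by linarith : 0 < M) hlp]) hw
  have hV'0 : 0 ≤ V' := hV.trans (le_max_left _ _)
  -- At eightfold prices no single lottery has excess over V' above its price. For boosted lotteries
  -- this is 8 · 3/16 = 3/2, the constant in `hex`; for single items it is w(8) ≤ V'.
  have hupper : maxUtility (priceScale 8 (boosted S)) v ≤ ENNReal.ofReal V' := by
    have hsys := isLotterySystem_priceScale (isLotterySystem_boosted hS) (c := 8)
      (by norm_num)
    refine iSup₂_le fun m b => iSup_le fun hb => ENNReal.ofReal_le_ofReal ?_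
    refine bundleUtility_le (fun l hl => hsys.valid hl) hV'0 ?_ hb
    rintro ⟨φ, q⟩ (⟨l', hl', h⟩ | ⟨i, hi, h⟩) <;> simp only [Prod.mk.injEq] at h <;>
      obtain ⟨rfl, h⟩ := h
    · have h1 : ∀ i, min (l'.1 i) (1 / (130 * (n:ℝ) ^ 3)) * max ((v i : ℝ) - V') 0 ≤
          l'.1 i * max ((v i : ℝ) - V) 0 := fun i =>
        mul_le_mul (min_le_left _ _) (max_le_max_right _ (sub_le_sub_left (le_max_left _ _) _))
          (le_max_right _ _) (hS.prob_nonneg l' hl' i)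
      have h2 := (Finset.sum_le_sum fun i (_ : i ∈ Finset.univ) => h1 i).trans (hex l' hl')
      have h3 := mul_le_mul_of_nonneg_left h2 (by linarith : 0 ≤ M)
      simp only [mul_assoc, ← Finset.mul_sum]
      simp only [hMdef, mul_assoc] at h3 h ⊢
      linarith
    · simp only
      rw [sum_single_mul i fun j => max ((v j : ℝ) - V') 0]
      have h1 := sub_le_surplus (v := v) (s := 8) (by norm_num) hi
      have h2 : surplus (basePrice S) v 8 ≤ V' := le_max_right _ _
      have h3 : 0 ≤ (basePrice S i).toReal := ENNReal.toReal_nonneg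
      refine max_le ?_ ?_ <;> linarith
  -- An item of value V at base price at most P, together with the boosted `l`, has utility at least
  -- V + (3/8 - 3/16) M P - P. This is at least V' + (M/8 - 1) P, and M/8 - 1 ≥ 15.
  have hlower : ENNReal.ofReal (V' + 15 * l.2) ≤ maxUtility (boosted S) v := by
    have hL₀ : ∃ L₀ : List (Lottery n), (∀ l ∈ L₀, l ∈ boosted S) ∧
        V ≤ expectBest v id L₀ 0 ∧ listPrice L₀ ≤ l.2 := by
      rcases hVk with h | ⟨k, hk, h⟩
      · exact ⟨[], by simp, by simp [expectBest, h], by simpa [listPrice] using hlp.le⟩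
      · have hk' : basePrice S k ≠ ∞ := ne_top_of_le_ne_top ENNReal.ofReal_ne_top hk
        refine ⟨[(Pi.single k 1, (basePrice S k).toReal)], ?_, ?_, ?_⟩
        · intro l' hl'
          rw [List.mem_singleton.1 hl']
          exact Or.inr ⟨k, hk', rfl⟩
        · rw [expectBest_singleton_zero, sum_single_mul k fun j => (v j : ℝ), h]
        · simpa [listPrice] using ENNReal.toReal_le_of_le_ofReal hlp.le hk
    obtain ⟨L₀, h1, h2, h3⟩ := hL₀
    set χ : Lottery n := (fun i => 130 * (n:ℝ) ^ 2 * min (l.1 i) (1 / (130 * (n:ℝ) ^ 3)),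
      130 * (n:ℝ) ^ 2 * (3 / 16) * l.2)
    have hχ : χ ∈ boosted S := Or.inl ⟨l, hl, rfl⟩
    have h4 := expectBest_cons_ge_excess (v := v) ((isLotterySystem_boosted hS).valid hχ)
      (fun l hl => (isLotterySystem_boosted hS).valid (h1 l hl)) hV h2
    have h5 : ∑ i, χ.1 i * max ((v i : ℝ) - V) 0 = M * smallExcess v V l.1 := by
      simp only [χ, smallExcess, mul_assoc, ← Finset.mul_sum, hMdef]
    have h6 := mul_le_mul_of_nonneg_left hbig (by linarith : 0 ≤ M)
    refine le_trans (ENNReal.ofReal_le_ofReal ?_)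
      (le_maxUtility (v := v) (L := χ :: L₀) (List.forall_mem_cons.2 ⟨hχ, h1⟩))
    have h7 : listPrice (χ :: L₀) = M * (3 / 16) * l.2 + listPrice L₀ := by
      simp [listPrice, χ, hMdef]
    rw [listUtility, h7]
    nlinarith
  calc ENNReal.ofReal (15 * l.2) = ENNReal.ofReal (V' + 15 * l.2) - ENNReal.ofReal V' := by
        rw [← ENNReal.ofReal_sub _ hV'0]; congr 1; ring
    _ ≤ _ := tsub_le_tsub hlower hupper

/-! ### Pointwise bounds on the payment. -/

theorem BuysSingle.payment_eq_zero_or {S : Set (Lottery n)} {v : Fin n → ℝ≥0}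
    (h : BuysSingle S v) : payment S v = 0 ∨ ∃ l ∈ S, payment S v = ENNReal.ofReal l.2 ∧
      ∀ L : List (Lottery n), (∀ l ∈ L, l ∈ S) → listUtility v L ≤ listUtility v [l] := by
  obtain ⟨m, b, hm, hb, hp⟩ := h
  interval_cases m
  · left
    rw [← hp]
    simp [bundlePrice]
  · right
    refine ⟨b 0, hb.1 0, by rw [← hp]; simp [bundlePrice], fun L hL => ?_⟩
    have h := hb.listUtility_le hL
    rw [bundleUtility_eq] at h
    simpa using h

/-- Geometrically weighted payments at the scales beyond the range of the algorithm. -/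
noncomputable def tailPay (p : Fin n → ℝ≥0∞) (v : Fin n → ℝ≥0) : ℝ≥0∞ :=
  ∑' i : ℕ, ENNReal.ofReal ((Real.exp 1)⁻¹ ^ (i + 5)) *
    itemPayment (scaled p (topScale n * Real.exp 1 ^ i)) v

theorem ofReal_sum_le_tailPay [NeZero n] (p : Fin n → ℝ≥0∞) (v : Fin n → ℝ≥0) (d : ℕ) :
    ENNReal.ofReal (∑ i ∈ Finset.range d, 130 * (n:ℝ) ^ 3 / (topScale n * Real.exp 1 ^ i) *
      scaledPay p v (topScale n * Real.exp 1 ^ i)) ≤ tailPay p v := by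
  have hn := one_le_cast (n := n)
  have hw : ∀ i : ℕ, 130 * (n:ℝ) ^ 3 / (topScale n * Real.exp 1 ^ i) =
      (Real.exp 1)⁻¹ ^ (i + 5) := by
    intro i
    rw [topScale, inv_pow, pow_add]
    field_simp
  rw [ENNReal.ofReal_sum_of_nonneg fun i _ => by
    rw [hw]; exact mul_nonneg (by positivity) (scaledPay_nonneg _ _ _)]
  refine le_trans (le_of_eq ?_) (ENNReal.sum_le_tsum (Finset.range d))
  refine Finset.sum_congr rfl fun i _ => ?_
  rw [hw, ENNReal.ofReal_mul (by positivity), ofReal_scaledPay]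

/-- Sum of the payments at the scales of the algorithm. -/
noncomputable def rangePay (p : Fin n → ℝ≥0∞) (v : Fin n → ℝ≥0) : ℝ≥0∞ :=
  ∑ j ∈ Finset.range (3 * Nat.log 2 n + 11), itemPayment (scaled p ((2:ℝ) ^ ((j : ℤ) - 1))) v

theorem ofReal_surplus_sub_le [NeZero n] (p : Fin n → ℝ≥0∞) (v : Fin n → ℝ≥0) :
    ENNReal.ofReal (surplus p v (1 / 2) - surplus p v (topScale n)) ≤ 310 * rangePay p v := by
  refine (ENNReal.ofReal_le_ofReal (surplus_sub_le p v)).trans (le_of_eq ?_)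
  rw [ENNReal.ofReal_mul (by norm_num), ENNReal.ofReal_sum_of_nonneg
    fun j _ => scaledPay_nonneg _ _ _]
  simp [rangePay, ofReal_scaledPay]

theorem surplus_sub_nonneg [NeZero n] (p : Fin n → ℝ≥0∞) (v : Fin n → ℝ≥0) :
    0 ≤ surplus p v (1 / 2) - surplus p v (topScale n) :=
  sub_nonneg.2 (surplus_anti p v (by norm_num) (by linarith [topScale_ge (n := n)]))

/-- The payment of a type that buys a single lottery, bounded by its payments under the rounded
prices and under competing systems. -/
theorem IsLotterySystem.payment_le_of_buysSingle [NeZero n] {S : Set (Lottery n)}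
    (hS : IsLotterySystem S) {v : Fin n → ℝ≥0} (hv : BuysSingle S v) :
    payment S v ≤ 2480 * rangePay (basePrice S) v + 8 * tailPay (basePrice S) v +
      15⁻¹ * (maxUtility (boosted S) v - maxUtility (priceScale 8 (boosted S)) v) := by
  rcases hv.payment_eq_zero_or with h | ⟨l, hl, hp, hopt⟩
  · rw [h]; exact zero_le
  obtain ⟨V, hV, hVk, -, hex, d, hd⟩ := hS.exists_threshold hl hopt
  rw [hp]
  have hW := ofReal_surplus_sub_le (basePrice S) v
  have hW0 := surplus_sub_nonneg (basePrice S) v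
  have hC := ofReal_sum_le_tailPay (basePrice S) v d
  set W := surplus (basePrice S) v (1 / 2) - surplus (basePrice S) v (topScale n)
  set D := ∑ i ∈ Finset.range d, 130 * (n:ℝ) ^ 3 / (topScale n * Real.exp 1 ^ i) *
      scaledPay (basePrice S) v (topScale n * Real.exp 1 ^ i)
  have hW8 : 8 * ENNReal.ofReal W ≤ 2480 * rangePay (basePrice S) v := by
    calc 8 * ENNReal.ofReal W ≤ 8 * (310 * rangePay (basePrice S) v) := by gcongr
      _ = _ := by rw [← mul_assoc]; norm_num
  -- At most 3/8 of the price in `smallExcess` leaves 1/2 - 3/8 = 1/8 for the surplus drop and the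
  -- tail, whence the factor 8 and 2480 = 8 · 310.
  rcases le_or_gt (smallExcess v V l.1) (3 / 8 * l.2) with hs | hs
  · refine le_trans ?_ (le_add_of_nonneg_right zero_le)
    have h1 : l.2 ≤ 8 * W + 8 * D := by linarith
    refine (ENNReal.ofReal_le_ofReal h1).trans (ENNReal.ofReal_add_le.trans ?_)
    rw [ENNReal.ofReal_mul (by norm_num), ENNReal.ofReal_mul (by norm_num),
      ENNReal.ofReal_ofNat]
    gcongr
  · rcases hS.boosted_alternative hl hV hVk hex hs.le with h | h
    · rw [add_assoc]
      refine le_trans ?_ (le_add_of_nonneg_right zero_le)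
      refine le_trans (ENNReal.ofReal_le_ofReal (show l.2 ≤ 8 * W by linarith)) ?_
      rwa [ENNReal.ofReal_mul (by norm_num), ENNReal.ofReal_ofNat]
    · refine le_trans ?_ (le_add_of_nonneg_left zero_le)
      rw [ENNReal.ofReal_mul (by norm_num), ENNReal.ofReal_ofNat] at h
      calc ENNReal.ofReal l.2 = 15⁻¹ * (15 * ENNReal.ofReal l.2) := by
            rw [← mul_assoc, ENNReal.inv_mul_cancel (by norm_num) (by norm_num), one_mul]
        _ ≤ _ := by gcongr

/-- A bound on payments that does not involve competing systems. -/
theorem IsLotterySystem.exists_payment_le [NeZero n] {S : Set (Lottery n)}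
    (hS : IsLotterySystem S) : ∃ c : ℝ, ∀ v, BuysSingle S v →
    payment S v ≤ 620 * rangePay (basePrice S) v + 2 * tailPay (basePrice S) v +
      ENNReal.ofReal c := by
  classical
  -- If some lottery offers item i with positive probability, its price bounds the excess of v i
  -- over V uniformly in v; if none does, the term vanishes.
  have hpt : ∀ i : Fin n, ∃ c : ℝ, 0 ≤ c ∧ ∀ v : Fin n → ℝ≥0, ∀ V : ℝ,
      (∀ l' ∈ S, ∑ i, l'.1 i * max ((v i : ℝ) - V) 0 ≤ 3 / 2 * l'.2) →
      ∀ l ∈ S, min (l.1 i) (1 / (130 * (n:ℝ) ^ 3)) * max ((v i : ℝ) - V) 0 ≤ c := by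
    intro i
    by_cases h : ∃ l' ∈ S, 0 < l'.1 i
    · obtain ⟨l', hl', hpos⟩ := h
      have hp' := hS.price_pos l' hl'
      refine ⟨3 / 2 * l'.2 / l'.1 i, by positivity, fun v V hex l hl => ?_⟩
      have h1 : l'.1 i * max ((v i : ℝ) - V) 0 ≤ 3 / 2 * l'.2 :=
        (Finset.single_le_sum (f := fun i => l'.1 i * max ((v i : ℝ) - V) 0)
          (fun i _ => mul_nonneg (hS.prob_nonneg l' hl' i) (le_max_right _ _))
          (Finset.mem_univ i)).trans (hex l' hl')
      have h2 : max ((v i : ℝ) - V) 0 ≤ 3 / 2 * l'.2 / l'.1 i := (le_div_iff₀' hpos).2 h1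
      have h3 : min (l.1 i) (1 / (130 * (n:ℝ) ^ 3)) ≤ 1 := by
        refine (min_le_left _ _).trans ?_
        exact (Finset.single_le_sum (fun j _ => hS.prob_nonneg l hl j)
          (Finset.mem_univ i)).trans (hS.prob_sum_le_one l hl)
      exact (mul_le_of_le_one_left (le_max_right _ _) h3).trans h2
    · push Not at h
      refine ⟨0, le_rfl, fun v V _ l hl => ?_⟩
      have h0 : l.1 i = 0 := le_antisymm (h l hl) (hS.prob_nonneg l hl i)
      rw [h0, min_eq_left (by positivity), zero_mul]
  choose c hc0 hc using hpt
  refine ⟨2 * ∑ i, c i, fun v hv => ?_⟩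
  rcases hv.payment_eq_zero_or with h | ⟨l, hl, hp, hopt⟩
  · rw [h]; exact zero_le
  obtain ⟨V, hV, hVk, -, hex, d, hd⟩ := hS.exists_threshold hl hopt
  rw [hp]
  have hW := ofReal_surplus_sub_le (basePrice S) v
  have hC := ofReal_sum_le_tailPay (basePrice S) v d
  set W := surplus (basePrice S) v (1 / 2) - surplus (basePrice S) v (topScale n)
  set D := ∑ i ∈ Finset.range d, 130 * (n:ℝ) ^ 3 / (topScale n * Real.exp 1 ^ i) *
      scaledPay (basePrice S) v (topScale n * Real.exp 1 ^ i)
  have hs : smallExcess v V l.1 ≤ ∑ i, c i :=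
    Finset.sum_le_sum fun i _ => hc i v V hex l hl
  have h1 : l.2 ≤ 2 * W + 2 * D + 2 * ∑ i, c i := by linarith
  refine (ENNReal.ofReal_le_ofReal h1).trans (ENNReal.ofReal_add_le.trans ?_)
  gcongr
  refine ENNReal.ofReal_add_le.trans ?_
  rw [ENNReal.ofReal_mul (by norm_num), ENNReal.ofReal_mul (by norm_num), ENNReal.ofReal_ofNat]
  refine add_le_add ?_ (by gcongr)
  calc 2 * ENNReal.ofReal W ≤ 2 * (310 * rangePay (basePrice S) v) := by gcongr
      _ = _ := by rw [← mul_assoc]; norm_num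

/-! ### Measurability of item payments. -/

open MeasureTheory

theorem measurableSet_isBestItem (q : Fin n → ℝ≥0∞) (i : Fin n) :
    MeasurableSet {v : Fin n → ℝ≥0 | IsBestItem q v i} := by
  have hm : ∀ j : Fin n, Measurable fun v : Fin n → ℝ≥0 => (v j : ℝ≥0∞) := fun j =>
    measurable_coe_nnreal_ennreal.comp (measurable_pi_apply j)
  have e : {v : Fin n → ℝ≥0 | IsBestItem q v i} = {v | q i ≤ (v i : ℝ≥0∞)} ∩
      ⋂ k, {v | (v k : ℝ≥0∞) + q i ≤ (v i : ℝ≥0∞) + q k} := by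
    ext v
    simp [IsBestItem]
  rw [e]
  exact (measurableSet_le measurable_const (hm i)).inter
    (.iInter fun k => measurableSet_le ((hm k).add_const _) ((hm i).add_const _))

theorem measurable_itemPayment (q : Fin n → ℝ≥0∞) : Measurable (itemPayment q) := by
  classical
  have e : itemPayment q = fun v => ⨆ i, {v | IsBestItem q v i}.indicator (fun _ => q i) v := by
    funext v
    refine iSup_congr fun i => ?_
    by_cases h : IsBestItem q v i <;> simp [h]
  rw [e]
  exact .iSup fun i => measurable_const.indicator (measurableSet_isBestItem q i)

/-! ### Expected revenue of the rounding -/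

theorem tsum_bind_mul {α β : Type*} (P : PMF α) (f : α → PMF β) (g : β → ℝ≥0∞) :
    ∑' b, P.bind f b * g b = ∑' a, P a * ∑' b, f a b * g b := by
  simp_rw [PMF.bind_apply, ← ENNReal.tsum_mul_right, ← ENNReal.tsum_mul_left]
  rw [ENNReal.tsum_comm]
  simp_rw [mul_assoc]

theorem tsum_map_mul {α β : Type*} (P : PMF α) (f : α → β) (g : β → ℝ≥0∞) :
    ∑' b, P.map f b * g b = ∑' a, P a * g (f a) := by
  classical
  rw [← PMF.bind_pure_comp, tsum_bind_mul]
  refine tsum_congr fun a => ?_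
  simp [PMF.pure_apply]

theorem roundedRevenue_eq [NeZero n] (C : Measure (Fin n → ℝ≥0)) (S : Set (Lottery n)) :
    roundedRevenue C S = 2⁻¹ * (∑' q, scaleAll (basePrice S) q * itemRevenue C q) +
      2⁻¹ * (∑' q, scaleOne (basePrice S) q * itemRevenue C q) := by
  rw [roundedRevenue, roundedPricing, tsum_bind_mul, tsum_fintype, Fintype.sum_bool]
  simp

theorem ofReal_two_zpow (z : ℤ) : ENNReal.ofReal ((2:ℝ) ^ z) = 2 ^ z := by
  rcases z with k | k
  · simp [ENNReal.ofReal_pow]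
  · rw [zpow_negSucc, zpow_negSucc, ENNReal.ofReal_inv_of_pos (by positivity),
      ENNReal.ofReal_pow (by norm_num), ENNReal.ofReal_ofNat]

theorem sum_itemRevenue_le [NeZero n] (C : Measure (Fin n → ℝ≥0)) (S : Set (Lottery n)) :
    ∑ j ∈ Finset.range (3 * Nat.log 2 n + 11),
      itemRevenue C (scaled (basePrice S) ((2:ℝ) ^ ((j : ℤ) - 1))) ≤
    2 * ((3 * Nat.log 2 n + 11 : ℕ) : ℝ≥0∞) * roundedRevenue C S := by
  set m := 3 * Nat.log 2 n + 11
  have h1 : ∑ j ∈ Finset.range m, (m : ℝ≥0∞)⁻¹ *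
      itemRevenue C (scaled (basePrice S) ((2:ℝ) ^ ((j : ℤ) - 1))) ≤
      ∑' q, scaleAll (basePrice S) q * itemRevenue C q := by
    rw [scaleAll, tsum_map_mul]
    -- The exponents start at -1, so the index is shifted by one.
    let f : ℕ ↪ ℤ := ⟨fun j => (j : ℤ) - 1, fun a b h => by simpa using h⟩
    refine le_trans (le_of_eq ?_) (ENNReal.sum_le_tsum ((Finset.range m).map f))
    rw [Finset.sum_map]
    refine Finset.sum_congr rfl fun j hj => ?_
    have hj' : (j : ℤ) - 1 ∈ Finset.Icc (-1 : ℤ) (3 * (Nat.log 2 n : ℤ) + 9) := by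
      rw [Finset.mem_range] at hj
      rw [Finset.mem_Icc]
      omega
    have hcard : (Finset.Icc (-1 : ℤ) (3 * (Nat.log 2 n : ℤ) + 9)).card = m := by
      rw [Int.card_Icc]
      omega
    rw [show f j = (j : ℤ) - 1 from rfl, PMF.uniformOfFinset_apply, if_pos hj', hcard]
    congr 2
    funext i
    rw [scaled, ofReal_two_zpow]
  have hm0 : (m : ℝ≥0∞) ≠ 0 := by
    simp [m]
  rw [← Finset.mul_sum] at h1
  have h2 : 2⁻¹ * ∑' q, scaleAll (basePrice S) q * itemRevenue C q ≤ roundedRevenue C S := by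
    rw [roundedRevenue_eq]
    exact le_self_add
  set A := ∑ j ∈ Finset.range m, itemRevenue C (scaled (basePrice S) ((2:ℝ) ^ ((j : ℤ) - 1)))
  calc A = 2 * m * (2⁻¹ * ((m : ℝ≥0∞)⁻¹ * A)) := by
        have e : 2 * (m : ℝ≥0∞) * (2⁻¹ * ((m : ℝ≥0∞)⁻¹ * A)) =
          (2 * 2⁻¹) * ((m : ℝ≥0∞) * (m : ℝ≥0∞)⁻¹) * A := by ring
        rw [e, ENNReal.mul_inv_cancel two_ne_zero ENNReal.ofNat_ne_top,
          ENNReal.mul_inv_cancel hm0 (ENNReal.natCast_ne_top m), one_mul, one_mul]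
    _ ≤ 2 * m * roundedRevenue C S := by
        gcongr
        exact le_trans (by gcongr) h2

theorem lintegral_rangePay [NeZero n] (C : Measure (Fin n → ℝ≥0)) (p : Fin n → ℝ≥0∞) :
    ∫⁻ v, rangePay p v ∂C = ∑ j ∈ Finset.range (3 * Nat.log 2 n + 11),
      itemRevenue C (scaled p ((2:ℝ) ^ ((j : ℤ) - 1))) :=
  lintegral_finsetSum _ fun _ _ => measurable_itemPayment _

theorem measurable_rangePay [NeZero n] (p : Fin n → ℝ≥0∞) : Measurable (rangePay p) :=
  Finset.measurable_sum _ fun _ _ => measurable_itemPayment _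

theorem measurable_tailPay (p : Fin n → ℝ≥0∞) : Measurable (tailPay p) :=
  .tsum fun _ => (measurable_itemPayment _).const_mul _

theorem lintegral_tailPay (C : Measure (Fin n → ℝ≥0)) (p : Fin n → ℝ≥0∞) :
    ∫⁻ v, tailPay p v ∂C = ∑' i : ℕ, ENNReal.ofReal ((Real.exp 1)⁻¹ ^ (i + 5)) *
      itemRevenue C (scaled p (topScale n * Real.exp 1 ^ i)) := by
  unfold tailPay
  rw [lintegral_tsum fun _ => ((measurable_itemPayment _).const_mul _).aemeasurable]
  exact tsum_congr fun i => lintegral_const_mul _ (measurable_itemPayment _)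

theorem geometricLaw_apply (j : ℕ) :
    geometricLaw j = ENNReal.ofReal ((1 - (Real.exp 1)⁻¹) * (Real.exp 1)⁻¹ ^ j) := rfl

theorem inv_exp_le_half : (Real.exp 1)⁻¹ ≤ 1 / 2 := by
  rw [one_div]
  exact inv_anti₀ two_pos (by linarith [Real.exp_one_gt_d9])

theorem ofReal_inv_exp_pow_le (j : ℕ) :
    ENNReal.ofReal ((Real.exp 1)⁻¹ ^ j) ≤ 2 * geometricLaw j := by
  rw [geometricLaw_apply, ← ENNReal.ofReal_ofNat 2, ← ENNReal.ofReal_mul (by norm_num)]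
  refine ENNReal.ofReal_le_ofReal ?_
  have h : 0 ≤ (Real.exp 1)⁻¹ ^ j := by positivity
  nlinarith [inv_exp_le_half]

/-- An item bought under all the prices is still bought when it alone is offered at its price. -/
theorem itemPayment_le_sum_single [NeZero n] (q : Fin n → ℝ≥0∞) (v : Fin n → ℝ≥0) :
    itemPayment q v ≤ ∑ k, itemPayment (Function.update (fun _ => ∞) k (q k)) v := by
  refine iSup₂_le fun k hk => ?_
  have hbest : IsBestItem (Function.update (fun _ => ∞) k (q k)) v k := by
    refine ⟨by simpa using hk.1, fun j => ?_⟩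
    by_cases h : j = k
    · subst h; exact le_rfl
    · simp [Function.update_of_ne h]
  refine le_trans ?_ (Finset.single_le_sum
    (f := fun k => itemPayment (Function.update (fun _ => ∞) k (q k)) v)
    (fun _ _ => zero_le) (Finset.mem_univ k))
  refine le_trans (le_of_eq ?_) (le_iSup₂_of_le k hbest le_rfl)
  simp

/-- The revenue at the scales beyond the range of the first branch is collected, up to a factor
depending on `n`, by the second branch. -/
theorem lintegral_tailPay_le [NeZero n] (C : Measure (Fin n → ℝ≥0)) (S : Set (Lottery n)) :
    ∫⁻ v, tailPay (basePrice S) v ∂C ≤ 4 * n * roundedRevenue C S := by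
  set p := basePrice S
  let f : Fin n → ℕ → Fin n → ℝ≥0∞ := fun k j =>
    Function.update (fun _ => ∞) k (130 * (n : ℝ≥0∞) ^ 3 * ENNReal.ofReal (Real.exp 1) ^ j * p k)
  have hone : ∑' q, scaleOne p q * itemRevenue C q =
      ∑ k, (n : ℝ≥0∞)⁻¹ * ∑' j, geometricLaw j * itemRevenue C (f k j) := by
    rw [scaleOne, tsum_bind_mul, tsum_fintype]
    refine Finset.sum_congr rfl fun k _ => ?_
    rw [tsum_map_mul]
    simp [f]
  have hrev : ∀ i : ℕ, itemRevenue C (scaled p (topScale n * Real.exp 1 ^ i)) ≤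
      ∑ k, itemRevenue C (f k (i + 5)) := by
    intro i
    have e : ∑ k, itemRevenue C (f k (i + 5)) = ∫⁻ v, ∑ k, itemPayment (f k (i + 5)) v ∂C :=
      (lintegral_finsetSum _ fun _ _ => measurable_itemPayment _).symm
    rw [e]
    refine lintegral_mono fun v => (itemPayment_le_sum_single _ v).trans (le_of_eq ?_)
    refine Finset.sum_congr rfl fun k _ => ?_
    simp only [f]
    congr 2
    rw [scaled, topScale, mul_assoc _ (Real.exp 1 ^ 5), ← pow_add, add_comm 5,
      ENNReal.ofReal_mul (by positivity), ENNReal.ofReal_mul (by norm_num),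
      ENNReal.ofReal_pow (by positivity), ENNReal.ofReal_pow (by positivity),
      ENNReal.ofReal_natCast, ENNReal.ofReal_ofNat]
  have h1 : ∫⁻ v, tailPay p v ∂C ≤
      2 * ∑ k, ∑' j, geometricLaw j * itemRevenue C (f k j) := by
    rw [lintegral_tailPay]
    calc _ ≤ ∑' i : ℕ, ∑ k, 2 * (geometricLaw (i + 5) * itemRevenue C (f k (i + 5))) := by
          refine ENNReal.tsum_le_tsum fun i => ?_
          rw [← Finset.mul_sum, ← Finset.mul_sum, ← mul_assoc]
          exact mul_le_mul' (ofReal_inv_exp_pow_le _) (hrev i)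
      _ = ∑ k, ∑' i : ℕ, 2 * (geometricLaw (i + 5) * itemRevenue C (f k (i + 5))) :=
          Summable.tsum_finsetSum fun _ _ => ENNReal.summable
      _ = 2 * ∑ k, ∑' i : ℕ, geometricLaw (i + 5) * itemRevenue C (f k (i + 5)) := by
          rw [Finset.mul_sum]
          exact Finset.sum_congr rfl fun k _ => ENNReal.tsum_mul_left
      _ ≤ _ := by
          refine mul_le_mul_right (Finset.sum_le_sum fun k _ => ?_) _
          -- The tail starts at `topScale`, which is the index j = 5 of the second branch; the
          -- smaller indices are discarded.
          exact ENNReal.tsum_comp_le_tsum_of_injective (add_left_injective 5)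
            fun j => geometricLaw j * itemRevenue C (f k j)
  have h2 : 2⁻¹ * ∑' q, scaleOne p q * itemRevenue C q ≤ roundedRevenue C S := by
    rw [roundedRevenue_eq]
    exact le_add_self
  rw [hone, ← Finset.mul_sum] at h2
  have hn0 : (n : ℝ≥0∞) ≠ 0 := by simp [NeZero.ne n]
  set A := ∑ k, ∑' j, geometricLaw j * itemRevenue C (f k j)
  calc _ ≤ 2 * A := h1
    _ = 4 * n * (2⁻¹ * ((n : ℝ≥0∞)⁻¹ * A)) := by
        have e : 4 * (n : ℝ≥0∞) * (2⁻¹ * ((n : ℝ≥0∞)⁻¹ * A)) =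
          2 * ((2 * 2⁻¹) * ((n : ℝ≥0∞) * (n : ℝ≥0∞)⁻¹) * A) := by ring
        rw [e, ENNReal.mul_inv_cancel two_ne_zero ENNReal.ofNat_ne_top,
          ENNReal.mul_inv_cancel hn0 (ENNReal.natCast_ne_top n), one_mul, one_mul]
    _ ≤ _ := by gcongr

/-! ### Competing systems -/

/-- Item pricings with positive prices are lottery systems. -/
theorem itemRevenue_le_optLotteryRevenue [NeZero n] (C : Measure (Fin n → ℝ≥0))
    {q : Fin n → ℝ≥0∞} (hq : ∀ i, 0 < q i) : itemRevenue C q ≤ optLotteryRevenue C := by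
  set S : Set (Lottery n) :=
    (fun i => ((Pi.single i 1, (q i).toReal) : Lottery n)) '' {i | q i ≠ ∞}
  have hS : IsLotterySystem S := by
    refine isLotterySystem_of_valid ((Set.toFinite _).image _).isClosed ?_ ?_
    · rintro _ ⟨i, -, rfl⟩
      exact valid_single _ _
    · rintro _ ⟨i, hi, rfl⟩
      exact ENNReal.toReal_pos (hq i).ne' hi
  refine le_trans (lintegral_mono fun v => ?_) (le_iSup₂_of_le S hS le_rfl)
  refine iSup₂_le fun k hk => ?_
  have hfin : q k ≠ ∞ := ne_top_of_le_ne_top ENNReal.coe_ne_top hk.1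
  have hle : (q k).toReal ≤ v k := by
    have := ENNReal.toReal_mono ENNReal.coe_ne_top hk.1
    simpa using this
  set l : Lottery n := (Pi.single k 1, (q k).toReal)
  have hl : l ∈ S := ⟨k, hfin, rfl⟩
  have hu : bundleUtility v ![l] = v k - (q k).toReal := by
    rw [listUtility_singleton_bundle, listUtility, expectBest_singleton_zero,
      sum_single_mul k fun j => (v j : ℝ)]
    simp [listPrice, l]
  have hb : IsOptimalBundle S v ![l] := by
    refine ⟨fun j => by rw [Subsingleton.elim j 0]; exact hl, fun m b hb => ?_⟩
    rw [hu]
    -- The threshold is the item surplus itself: the excess of every item over it is at most its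
    -- price, so no bundle of items does better than one item.
    refine bundleUtility_le (fun l hl => hS.valid hl) (sub_nonneg.2 hle) ?_ hb
    rintro _ ⟨i, hi, rfl⟩
    simp only
    rw [sum_single_mul i fun j => max ((v j : ℝ) - (v k - (q k).toReal)) 0]
    have h1 := ENNReal.toReal_mono (by simpa using hi) (hk.2 i)
    rw [ENNReal.toReal_add ENNReal.coe_ne_top hfin, ENNReal.toReal_add ENNReal.coe_ne_top hi,
      ENNReal.coe_toReal, ENNReal.coe_toReal] at h1
    exact max_le (by linarith) ENNReal.toReal_nonneg
  have h := hb.ofReal_le_payment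
  have hp : bundlePrice ![l] = (q k).toReal := by simp [bundlePrice, l]
  rwa [hp, ENNReal.ofReal_toReal hfin] at h

theorem IsLotterySystem.revenue_le {S : Set (Lottery n)} (hS : IsLotterySystem S)
    (C : Measure (Fin n → ℝ≥0)) : lotteryRevenue C S ≤ optLotteryRevenue C :=
  le_iSup₂_of_le S hS le_rfl

/-- This converts a lower bound on a drop in utility into a lower bound on revenue, to be compared
with the optimum. -/
theorem IsLotterySystem.lintegral_maxUtility_sub_le {S : Set (Lottery n)}
    (hS : IsLotterySystem S) (C : Measure (Fin n → ℝ≥0)) :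
    ∫⁻ v, (maxUtility S v - maxUtility (priceScale 2 S) v) ∂C ≤ optLotteryRevenue C :=
  (lintegral_mono fun v => tsub_le_iff_left.2 (hS.maxUtility_le v)).trans (hS.revenue_le C)

theorem measurable_maxUtility_sub (S T : Set (Lottery n)) :
    Measurable fun v => maxUtility S v - maxUtility T v :=
  (measurable_maxUtility S).sub (measurable_maxUtility T)

theorem priceScale_priceScale (a b : ℝ) (S : Set (Lottery n)) :
    priceScale a (priceScale b S) = priceScale (a * b) S := by
  ext l
  simp [priceScale, div_div]

/-- A factor 8 is three doublings, each charged to the revenue of a different lottery system. -/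
theorem IsLotterySystem.lintegral_maxUtility_sub_le_three {S : Set (Lottery n)}
    (hS : IsLotterySystem S) (C : Measure (Fin n → ℝ≥0)) :
    ∫⁻ v, (maxUtility S v - maxUtility (priceScale 8 S) v) ∂C ≤ 3 * optLotteryRevenue C := by
  have h2 := isLotterySystem_priceScale hS (c := 2) two_pos
  have h4 := isLotterySystem_priceScale h2 (c := 2) two_pos
  have e : priceScale 8 S = priceScale 2 (priceScale 2 (priceScale 2 S)) := by
    rw [priceScale_priceScale, priceScale_priceScale]; norm_num
  have hm := measurable_maxUtility_sub (n := n)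
  rw [e]
  calc _ ≤ ∫⁻ v, ((maxUtility S v - maxUtility (priceScale 2 S) v) +
        ((maxUtility (priceScale 2 S) v - maxUtility (priceScale 2 (priceScale 2 S)) v) +
        (maxUtility (priceScale 2 (priceScale 2 S)) v -
          maxUtility (priceScale 2 (priceScale 2 (priceScale 2 S))) v))) ∂C :=
        lintegral_mono fun v => tsub_le_tsub_add_tsub.trans
          (add_le_add_right tsub_le_tsub_add_tsub _)
    _ ≤ optLotteryRevenue C + (optLotteryRevenue C + optLotteryRevenue C) := by
        rw [lintegral_add_left (hm _ _), lintegral_add_left (hm _ _)]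
        exact add_le_add (hS.lintegral_maxUtility_sub_le C)
          (add_le_add (h2.lintegral_maxUtility_sub_le C) (h4.lintegral_maxUtility_sub_le C))
    _ = _ := by ring

/-- Every scaled pricing earns at most the optimal lottery revenue, and the weights sum to e^(-5)/(1
- 1/e) ≤ 2/140. The factor e^5 in `topScale` serves to make this small. -/
theorem lintegral_tailPay_le_opt [NeZero n] {S : Set (Lottery n)} (hS : IsLotterySystem S)
    (C : Measure (Fin n → ℝ≥0)) :
    ∫⁻ v, tailPay (basePrice S) v ∂C ≤ 60⁻¹ * optLotteryRevenue C := by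
  have htop : 0 < topScale n := by linarith [topScale_ge (n := n)]
  rw [lintegral_tailPay]
  have hw : ∀ i : ℕ, ENNReal.ofReal ((Real.exp 1)⁻¹ ^ (i + 5)) ≤ 60⁻¹ * geometricLaw i := by
    intro i
    have e : (60⁻¹ : ℝ≥0∞) = ENNReal.ofReal 60⁻¹ := by
      rw [ENNReal.ofReal_inv_of_pos (by norm_num), ENNReal.ofReal_ofNat]
    rw [geometricLaw_apply, e, ← ENNReal.ofReal_mul (by norm_num), pow_add]
    refine ENNReal.ofReal_le_ofReal ?_
    have h1 : (Real.exp 1)⁻¹ ^ 5 ≤ 140⁻¹ := by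
      rw [inv_pow]
      exact inv_anti₀ (by norm_num) exp_five_bounds.1
    have h2 : (0:ℝ) ≤ (Real.exp 1)⁻¹ ^ i := by positivity
    have h3 := inv_exp_le_half
    nlinarith [mul_le_mul_of_nonneg_left h1 h2, mul_le_mul_of_nonneg_left h3 h2]
  calc _ ≤ ∑' i : ℕ, 60⁻¹ * optLotteryRevenue C * geometricLaw i := by
        refine ENNReal.tsum_le_tsum fun i => ?_
        rw [mul_right_comm]
        refine mul_le_mul' (hw i) (itemRevenue_le_optLotteryRevenue C fun k => ?_)
        exact ENNReal.mul_pos (ENNReal.ofReal_pos.2 (by positivity)).ne' (hS.basePrice_pos k).ne'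
    _ = _ := by rw [ENNReal.tsum_mul_left, PMF.tsum_coe, mul_one]

/-! ### The approximation -/

/-- The rounding applied to a system that is optimal up to a factor of two. -/
theorem IsLotterySystem.revenue_le_rounded [NeZero n] {S : Set (Lottery n)}
    (hS : IsLotterySystem S) {C : Measure (Fin n → ℝ≥0)} (hfin : optLotteryRevenue C ≠ ∞)
    (hopt : optLotteryRevenue C ≤ 2 * lotteryRevenue C S) (hv : ∀ᵐ v ∂C, BuysSingle S v) :
    lotteryRevenue C S ≤
      14880 * ((3 * Nat.log 2 n + 11 : ℕ) : ℝ≥0∞) * roundedRevenue C S := by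
  set R := lotteryRevenue C S with hR
  have hRfin : R ≠ ∞ := ne_top_of_le_ne_top hfin (hS.revenue_le C)
  set A := ∫⁻ v, rangePay (basePrice S) v ∂C with hA
  have h1 : R ≤ 2480 * A + 8 * (60⁻¹ * optLotteryRevenue C) +
      15⁻¹ * (3 * optLotteryRevenue C) := by
    have hm1 := (measurable_rangePay (basePrice S)).const_mul 2480
    have hm2 := (measurable_tailPay (basePrice S)).const_mul 8
    have hm12 : Measurable fun v =>
        2480 * rangePay (basePrice S) v + 8 * tailPay (basePrice S) v := hm1.add hm2
    calc R ≤ ∫⁻ v, (2480 * rangePay (basePrice S) v + 8 * tailPay (basePrice S) v +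
          15⁻¹ * (maxUtility (boosted S) v - maxUtility (priceScale 8 (boosted S)) v)) ∂C :=
          lintegral_mono_ae (hv.mono fun v hv => hS.payment_le_of_buysSingle hv)
      _ = 2480 * A + 8 * ∫⁻ v, tailPay (basePrice S) v ∂C + 15⁻¹ *
          ∫⁻ v, (maxUtility (boosted S) v - maxUtility (priceScale 8 (boosted S)) v) ∂C := by
          rw [lintegral_add_left hm12, lintegral_add_left hm1,
            lintegral_const_mul _ (measurable_rangePay _),
            lintegral_const_mul _ (measurable_tailPay _),
            lintegral_const_mul _ (measurable_maxUtility_sub _ _)]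
      _ ≤ _ := by
          gcongr
          · exact lintegral_tailPay_le_opt hS C
          · exact (isLotterySystem_boosted hS).lintegral_maxUtility_sub_le_three C
  have h2 : A ≤ 2 * ((3 * Nat.log 2 n + 11 : ℕ) : ℝ≥0∞) * roundedRevenue C S := by
    rw [hA, lintegral_rangePay]
    exact sum_itemRevenue_le C S
  -- Since the optimum is at most 2R, the last two terms of `h1` are at most (16/60 + 6/15) R =
  -- 2R/3, so R ≤ 3 · 2480 · A. Cancelling requires R finite.
  have h3 : R ≤ 7440 * A := by
    by_cases hAfin : A = ∞
    · rw [hAfin, ENNReal.mul_top (by norm_num)]; exact le_top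
    have h4 : R ≤ 2480 * A + 8 * (60⁻¹ * (2 * R)) + 15⁻¹ * (3 * (2 * R)) :=
      h1.trans (by gcongr)
    rw [← ENNReal.toReal_le_toReal hRfin (by finiteness)]
    have h5 := ENNReal.toReal_mono (by finiteness) h4
    rw [ENNReal.toReal_add (by finiteness) (by finiteness),
      ENNReal.toReal_add (by finiteness) (by finiteness)] at h5
    simp only [ENNReal.toReal_mul, ENNReal.toReal_inv, ENNReal.toReal_ofNat] at h5 ⊢
    linarith
  calc R ≤ 7440 * A := h3
    _ ≤ 7440 * (2 * ((3 * Nat.log 2 n + 11 : ℕ) : ℝ≥0∞) * roundedRevenue C S) := by gcongr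
    _ = _ := by rw [← mul_assoc, ← mul_assoc]; norm_num

theorem natLog_bound [NeZero n] :
    ((3 * Nat.log 2 n + 11 : ℕ) : ℝ≥0∞) ≤ ENNReal.ofReal (11 * (1 + Real.log n)) := by
  rw [← ENNReal.ofReal_natCast]
  refine ENNReal.ofReal_le_ofReal ?_
  have h1 : 2 ^ Nat.log 2 n ≤ n := Nat.pow_log_le_self 2 (NeZero.ne n)
  have h2 : (2:ℝ) ^ Nat.log 2 n ≤ n := by exact_mod_cast h1
  have h3 := Real.log_le_log (by positivity) h2
  rw [Real.log_pow] at h3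
  have h4 := Real.log_two_gt_d9
  push_cast
  nlinarith [(Nat.cast_nonneg (Nat.log 2 n) : (0:ℝ) ≤ _)]

theorem log_factor_nonneg [NeZero n] : 0 ≤ 1 + Real.log n := by
  have := Real.log_nonneg (one_le_cast (n := n))
  linarith

theorem IsLotterySystem.revenue_le_log_mul_rounded [NeZero n] {S : Set (Lottery n)}
    (hS : IsLotterySystem S) {C : Measure (Fin n → ℝ≥0)} (hfin : optLotteryRevenue C ≠ ∞)
    (hopt : optLotteryRevenue C ≤ 2 * lotteryRevenue C S) (hv : ∀ᵐ v ∂C, BuysSingle S v) :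
    lotteryRevenue C S ≤ ENNReal.ofReal (200000 * (1 + Real.log n)) * roundedRevenue C S := by
  refine (hS.revenue_le_rounded hfin hopt hv).trans (mul_le_mul_left ?_ _)
  calc 14880 * ((3 * Nat.log 2 n + 11 : ℕ) : ℝ≥0∞)
      ≤ 14880 * ENNReal.ofReal (11 * (1 + Real.log n)) := by gcongr; exact natLog_bound
    _ = ENNReal.ofReal (14880 * (11 * (1 + Real.log n))) := by
        rw [ENNReal.ofReal_mul (p := 14880) (by norm_num), ENNReal.ofReal_ofNat]
    _ ≤ _ := ENNReal.ofReal_le_ofReal (by linarith [log_factor_nonneg (n := n)])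

/-- If the revenue of the lottery system is infinite, so is that of the rounding. -/
theorem IsLotterySystem.roundedRevenue_eq_top [NeZero n] {S : Set (Lottery n)}
    (hS : IsLotterySystem S) {C : Measure (Fin n → ℝ≥0)} [IsFiniteMeasure C]
    (h : lotteryRevenue C S = ∞) (hv : ∀ᵐ v ∂C, BuysSingle S v) : roundedRevenue C S = ∞ := by
  by_contra hr
  obtain ⟨c, hc⟩ := hS.exists_payment_le
  -- If the rounding earned a finite amount, the first branch would make this integral finite, the
  -- second that of the tail, and the remaining constant is integrable because the measure is
  -- finite.
  have hA : ∫⁻ v, rangePay (basePrice S) v ∂C ≠ ∞ := by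
    rw [lintegral_rangePay]
    exact ne_top_of_le_ne_top (by finiteness) (sum_itemRevenue_le C S)
  have hT : ∫⁻ v, tailPay (basePrice S) v ∂C ≠ ∞ :=
    ne_top_of_le_ne_top (by finiteness) (lintegral_tailPay_le C S)
  have hm1 := (measurable_rangePay (basePrice S)).const_mul 620
  have hm2 := (measurable_tailPay (basePrice S)).const_mul 2
  have hm12 : Measurable fun v =>
      620 * rangePay (basePrice S) v + 2 * tailPay (basePrice S) v := hm1.add hm2
  have h1 : lotteryRevenue C S ≤ ∫⁻ v, (620 * rangePay (basePrice S) v +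
      2 * tailPay (basePrice S) v + ENNReal.ofReal c) ∂C :=
    lintegral_mono_ae (hv.mono fun v hv => hc v hv)
  rw [lintegral_add_left hm12, lintegral_add_left hm1,
    lintegral_const_mul _ (measurable_rangePay _), lintegral_const_mul _ (measurable_tailPay _),
    lintegral_const] at h1
  exact ne_top_of_le_ne_top (by finiteness) h1 h

theorem roundedRevenue_le_optItemRevenue [NeZero n] (C : Measure (Fin n → ℝ≥0))
    (S : Set (Lottery n)) : roundedRevenue C S ≤ optItemRevenue C := by
  calc roundedRevenue C S ≤ ∑' q, roundedPricing S q * optItemRevenue C :=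
        ENNReal.tsum_le_tsum fun q => mul_le_mul_right (le_iSup (itemRevenue C) q) _
    _ = optItemRevenue C := by rw [ENNReal.tsum_mul_right, PMF.tsum_coe, one_mul]

/-- An optimal system need not exist; one earning more than half of the optimum, replaced by its
single-purchase extension, suffices and costs a further factor 2. -/
theorem optLotteryRevenue_le_of_ne_top [NeZero n] {C : Measure (Fin n → ℝ≥0)}
    (hfin : optLotteryRevenue C ≠ ∞) :
    optLotteryRevenue C ≤ ENNReal.ofReal (400000 * (1 + Real.log n)) * optItemRevenue C := by
  rcases eq_or_ne (optLotteryRevenue C) 0 with h0 | h0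
  · rw [h0]; exact zero_le
  have hlt : optLotteryRevenue C / 2 < optLotteryRevenue C := ENNReal.half_lt_self h0 hfin
  obtain ⟨S, hS, hlt'⟩ : ∃ S : Set (Lottery n), ∃ _ : IsLotterySystem S,
      optLotteryRevenue C / 2 < lotteryRevenue C S := by
    conv_rhs at hlt => rw [optLotteryRevenue]
    simpa only [lt_iSup_iff] using hlt
  obtain ⟨S', hS', -, h⟩ := hS.exists_buysSingle
  have hrev : lotteryRevenue C S' = lotteryRevenue C S := lintegral_congr fun v => (h v).2
  have hle : optLotteryRevenue C ≤ 2 * lotteryRevenue C S' := by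
    rw [hrev]
    exact (ENNReal.div_le_iff' two_ne_zero ENNReal.ofNat_ne_top).1 hlt'.le
  have h1 := hS'.revenue_le_log_mul_rounded hfin hle (.of_forall fun v => (h v).1)
  calc optLotteryRevenue C ≤ 2 * lotteryRevenue C S' := hle
    _ ≤ 2 * (ENNReal.ofReal (200000 * (1 + Real.log n)) * optItemRevenue C) := by
        gcongr
        exact h1.trans (by gcongr; exact roundedRevenue_le_optItemRevenue C S')
    _ = _ := by
        rw [← mul_assoc, ← ENNReal.ofReal_ofNat 2, ← ENNReal.ofReal_mul (by norm_num)]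
        congr 2
        ring

/-! ### Truncation to bounded types. -/

/-- The types all of whose values are at most `M`. -/
def boundedTypes (n M : ℕ) : Set (Fin n → ℝ≥0) := {v | ∀ i, v i ≤ M}

theorem measurableSet_boundedTypes (M : ℕ) : MeasurableSet (boundedTypes n M) := by
  have e : boundedTypes n M = ⋂ i, {v : Fin n → ℝ≥0 | v i ≤ M} := by ext; simp [boundedTypes]
  rw [e]
  exact .iInter fun i => measurableSet_le (measurable_pi_apply i) measurable_const

theorem iUnion_boundedTypes : ⋃ M, boundedTypes n M = Set.univ := by
  refine Set.eq_univ_of_forall fun v => Set.mem_iUnion.2 ?_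
  obtain ⟨M, hM⟩ := exists_nat_ge (Finset.univ.sup v)
  exact ⟨M, fun i => (Finset.le_sup (Finset.mem_univ i)).trans hM⟩

/-- No type pays more than its highest value, which is at most M here. -/
theorem optLotteryRevenue_restrict_ne_top (C : Measure (Fin n → ℝ≥0)) [IsFiniteMeasure C]
    (M : ℕ) : optLotteryRevenue (C.restrict (boundedTypes n M)) ≠ ∞ := by
  have h : optLotteryRevenue (C.restrict (boundedTypes n M)) ≤ M * C Set.univ := by
    refine iSup₂_le fun S hS => ?_
    calc lotteryRevenue (C.restrict (boundedTypes n M)) S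
        ≤ ∫⁻ _v in boundedTypes n M, (M : ℝ≥0∞) ∂C := by
          refine setLIntegral_mono' (measurableSet_boundedTypes M) fun v hv => ?_
          refine (hS.payment_le v).trans ?_
          exact_mod_cast Finset.sup_le fun i _ => hv i
      _ ≤ M * C Set.univ := by
          rw [setLIntegral_const]
          gcongr
          exact Set.subset_univ _
  exact ne_top_of_le_ne_top (by finiteness) h

/-- Item pricings approximate lottery systems in the buy-many model. -/
theorem optLotteryRevenue_le [NeZero n] (C : Measure (Fin n → ℝ≥0)) [IsFiniteMeasure C] :
    optLotteryRevenue C ≤ ENNReal.ofReal (400000 * (1 + Real.log n)) * optItemRevenue C := by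
  refine iSup₂_le fun S hS => ?_
  have hdir : Directed (· ⊆ ·) (boundedTypes n) := by
    refine Monotone.directed_le (f := boundedTypes n) fun M M' h v hv i => (hv i).trans ?_
    exact_mod_cast h
  -- Exhaustion by an increasing sequence of sets needs no measurability of the payment.
  have e : lotteryRevenue C S = ⨆ M, lotteryRevenue (C.restrict (boundedTypes n M)) S := by
    simp only [lotteryRevenue]
    rw [← setLIntegral_iUnion_of_directed _ hdir, iUnion_boundedTypes, Measure.restrict_univ]
  rw [e]
  refine iSup_le fun M => (hS.revenue_le _).trans ?_
  refine (optLotteryRevenue_le_of_ne_top (optLotteryRevenue_restrict_ne_top C M)).trans ?_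
  gcongr
  exact iSup_mono fun q => lintegral_mono' Measure.restrict_le_self le_rfl

end BuyMany

/-! ### Assembly of the three parts. -/

theorem theorem4p1 :
    ∃ K : ℝ, 0 < K ∧ ∀ (n : ℕ) [NeZero n],
      (∀ (C : MeasureTheory.Measure (Fin n → NNReal)) [MeasureTheory.IsProbabilityMeasure C],
        (∀ S : Set (BuyMany.Lottery n), BuyMany.IsOptimalSystem C S →
          (∀ᵐ v ∂C, BuyMany.BuysSingle S v) →
          BuyMany.optLotteryRevenue C ≤
            ENNReal.ofReal (K * (1 + Real.log n)) * BuyMany.roundedRevenue C S) ∧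
        BuyMany.optLotteryRevenue C ≤
          ENNReal.ofReal (K * (1 + Real.log n)) * BuyMany.optItemRevenue C) ∧
      (∀ S : Set (BuyMany.Lottery n), BuyMany.IsLotterySystem S →
        ∃ S' : Set (BuyMany.Lottery n), BuyMany.IsLotterySystem S' ∧ S ⊆ S' ∧
          ∀ v : Fin n → NNReal, BuyMany.BuysSingle S' v ∧
            BuyMany.payment S' v = BuyMany.payment S v) := by
  refine ⟨400000, by norm_num, fun n _ => ⟨fun C _ => ⟨fun S ⟨hS, hopt⟩ hv => ?_,
    BuyMany.optLotteryRevenue_le C⟩, fun S hS => hS.exists_buysSingle⟩⟩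
  have hle : BuyMany.optLotteryRevenue C ≤ BuyMany.lotteryRevenue C S := iSup₂_le hopt
  have hlog := Real.log_nonneg (BuyMany.one_le_cast (n := n))
  refine hle.trans ?_
  -- With infinite revenue nothing can be absorbed, so the bound with an additive constant takes
  -- over.
  by_cases htop : BuyMany.lotteryRevenue C S = ∞
  · rw [hS.roundedRevenue_eq_top htop hv,
      ENNReal.mul_top (ENNReal.ofReal_pos.2 (by positivity)).ne']
    exact le_top
  · have h := hS.revenue_le_log_mul_rounded (ne_top_of_le_ne_top htop hle)
      (hle.trans (le_mul_of_one_le_left zero_le one_le_two)) hv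
    refine h.trans (mul_le_mul_left (ENNReal.ofReal_le_ofReal ?_) _)
    linarith
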